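/- Let $X$ be a smooth Riemannian manifold (without boundary) and let $\phi$ be a calibration of degree $p$ on $X$, that is, a smooth closed $p$-form with $\phi(e_1\wedge\dots\wedge e_p)\le 1$ for all orthonormal tangent vectors $e_1,\dots,e_p$ at a point of $X$. A $\phi$-plane at $x\in X$ is a unit simple $p$-vector $\xi=e_1\wedge\dots\wedge e_p$ at $x$ ($e_1,\dots,e_p\in T_xX$ orthonormal) with $\phi(\xi)=1$. For a smooth function $f$ let $\mathrm{Hess}\,f$ be the endomorphism $v\mapsto\nabla_v(\nabla f)$ of $TX$ ($\nabla$ being the Levi-Civita connection), and let $\mathcal H^\phi(f)$ be the $p$-form obtained by letting it act on $\phi$ as a derivation, $$\mathcal H^\phi(f)(v_1,\dots,v_p)=\sum_{k=1}^p\phi(v_1,\dots,(\mathrm{Hess}\,f)v_k,\dots,v_p).$$ A smooth function $f$ on an open set $V\subset X$ is strictly $\phi$-plurisubharmonic on $V$ if $\mathcal H^\phi(f)(\xi)>0$ for all $\phi$-planes $\xi$ at points of $V$. Assume that $(X,\phi)$ is strictly $\phi$-convex: there is a smooth strictly $\phi$-plurisubharmonic function $f:X\to\mathbb R$ all of whose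 sublevel sets $\{f\le c\}$, $c\in\mathbb R$, are compact. Let $\Omega\subset X$ be an open set with compact closure and smooth boundary: each $x\in\partial\Omega$ has an open neighborhood $U$ with a smooth function $\rho:U\to\mathbb R$ such that $\Omega\cap U=\{\rho<0\}$ and $\nabla\rho\ne0$ on $U\cap\partial\Omega$. A defining function for $\partial\Omega$ is a smooth function $\rho$ on an open neighborhood of $\overline\Omega$ with $\Omega=\{\rho<0\}$ and $\nabla\rho\neq0$ on $\partial\Omega$. A $\phi$-plane $\xi$ at $x\in\partial\Omega$ is tangential if $\mathrm{span}\,\xi\subset T_x\partial\Omega$. The boundary $\partial\Omega$ is strictly $\phi$-convex if for a defining function $\rho$ (the choice of which does not matter) $\mathcal H^\phi(\rho)(\xi)>0$ for all tangential $\phi$-planes $\xi$. Let $n$ be the outward-pointing unit normal of $\partial\Omega$, let $II_{\partial\Omega}(v,w)=\langle\nabla_vW,n\rangle$ for $v,w\in T_x\partial\Omega$, where $W$ is any smooth vector field near $x$ with $W(x)=w$ that is tangent to $\partial\Omega$ along $\partial\Omega$, and let $\mathrm{tr}_\xi II_{\partial\Omega}=\sum_{k=1}^pII_{\partial\Omega}(e_k,e_k)$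 for $\xi=e_1\wedge\dots\wedge e_p$ with $e_1,\dots,e_p$ orthonormal. Then the following are equivalent: (i) $\partial\Omega$ is strictly $\phi$-convex; (ii) $\mathrm{tr}_\xi II_{\partial\Omega}<0$ for all tangential $\phi$-planes $\xi$; (iii) $\partial\Omega$ has a defining function that is strictly $\phi$-plurisubharmonic on a neighborhood of $\overline\Omega$. -/

import Mathlib

open Bundle Set Topology
open scoped Manifold ContDiff

set_option linter.unusedSectionVars false
set_option linter.style.haveILetI false

namespace CalibratedGeometry

/-! ### The Levi-Civita connection, built from the Koszul formula -/

section Koszul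

variable {E : Type*} [NormedAddCommGroup E] [NormedSpace ℝ E]
  {X : Type*} [TopologicalSpace X] [ChartedSpace E X] [IsManifold 𝓘(ℝ, E) ∞ X]
  [RiemannianBundle (fun x : X => TangentSpace 𝓘(ℝ, E) x)]
  [IsContMDiffRiemannianBundle 𝓘(ℝ, E) ∞ E (fun x : X => TangentSpace 𝓘(ℝ, E) x)]

/-- The right-hand side of the Koszul formula for `⟪∇_V W, Z⟫` at `x`:
`½ (V⟪W,Z⟫ + W⟪V,Z⟫ - Z⟪V,W⟫ + ⟪[V,W],Z⟫ - ⟪[V,Z],W⟫ - ⟪[W,Z],V⟫)`. -/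
noncomputable def koszul (W V Z : Π x : X, TangentSpace 𝓘(ℝ, E) x) (x : X) : ℝ :=
  (1 / 2 : ℝ) *
    (mvfderiv 𝓘(ℝ, E) (fun y => inner ℝ (W y) (Z y)) x (V x)
      + mvfderiv 𝓘(ℝ, E) (fun y => inner ℝ (V y) (Z y)) x (W x)
      - mvfderiv 𝓘(ℝ, E) (fun y => inner ℝ (V y) (W y)) x (Z x)
      + inner ℝ (VectorField.mlieBracket 𝓘(ℝ, E) V W x) (Z x)
      - inner ℝ (VectorField.mlieBracket 𝓘(ℝ, E) V Z x) (W x)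
      - inner ℝ (VectorField.mlieBracket 𝓘(ℝ, E) W Z x) (V x))

variable {W V Z W' V' Z' : Π x : X, TangentSpace 𝓘(ℝ, E) x} {x : X} {f : X → ℝ}

theorem mdiffAt_inner (hW : MDiffAt (T% W) x) (hV : MDiffAt (T% V) x) :
    MDiffAt (fun y => (inner ℝ (W y) (V y) : ℝ)) x :=
  MDifferentiableAt.inner_bundle (E := fun x : X => TangentSpace 𝓘(ℝ, E) x) hW hV

theorem mvfderiv_inner_add_right
    (hW : MDiffAt (T% W) x) (hV : MDiffAt (T% V) x) (hV' : MDiffAt (T% V') x) :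
    mvfderiv 𝓘(ℝ, E) (fun y => (inner ℝ (W y) ((V + V') y) : ℝ)) x =
      mvfderiv 𝓘(ℝ, E) (fun y => (inner ℝ (W y) (V y) : ℝ)) x +
      mvfderiv 𝓘(ℝ, E) (fun y => (inner ℝ (W y) (V' y) : ℝ)) x := by
  rw [← mvfderiv_add (mdiffAt_inner hW hV) (mdiffAt_inner hW hV')]
  congr 1; ext y; simp [inner_add_right]

theorem mvfderiv_inner_smul_right
    (hf : MDiffAt f x) (hW : MDiffAt (T% W) x) (hV : MDiffAt (T% V) x) :
    mvfderiv 𝓘(ℝ, E) (fun y => (inner ℝ (W y) ((f • V) y) : ℝ)) x =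
      f x • mvfderiv 𝓘(ℝ, E) (fun y => (inner ℝ (W y) (V y) : ℝ)) x +
      (inner ℝ (W x) (V x) : ℝ) • mvfderiv 𝓘(ℝ, E) f x := by
  rw [← mvfderiv_mul hf (mdiffAt_inner hW hV)]
  congr 1; ext y; simp [inner_smul_right]

theorem inner_comm_fun (W V : Π x : X, TangentSpace 𝓘(ℝ, E) x) :
    (fun y => (inner ℝ (W y) (V y) : ℝ)) = fun y => inner ℝ (V y) (W y) := by
  ext y; exact real_inner_comm _ _

variable [CompleteSpace E]

theorem tensorialAt_koszul_right (hW : MDiffAt (T% W) x) (hV : MDiffAt (T% V) x) :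
    TensorialAt 𝓘(ℝ, E) E (fun Z => koszul W V Z x) x where
  smul {f Z} hf hZ := by
    simp only [koszul]
    rw [mvfderiv_inner_smul_right hf hW hZ, mvfderiv_inner_smul_right hf hV hZ,
      VectorField.mlieBracket_smul_right hf hZ, VectorField.mlieBracket_smul_right hf hZ]
    simp [inner_add_left, inner_smul_left, inner_smul_right]
    rw [real_inner_comm (W x) (Z x), real_inner_comm (V x) (Z x)]
    ring
  add {Z Z'} hZ hZ' := by
    simp only [koszul]
    rw [mvfderiv_inner_add_right hW hZ hZ', mvfderiv_inner_add_right hV hZ hZ',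
      VectorField.mlieBracket_add_right hZ hZ', VectorField.mlieBracket_add_right hZ hZ']
    simp [inner_add_left, inner_add_right]
    ring

theorem tensorialAt_koszul_left (hW : MDiffAt (T% W) x) (hZ : MDiffAt (T% Z) x) :
    TensorialAt 𝓘(ℝ, E) E (fun V => koszul W V Z x) x where
  smul {f V} hf hV := by
    simp only [koszul]
    rw [inner_comm_fun (f • V) Z, inner_comm_fun (f • V) W,
      mvfderiv_inner_smul_right hf hZ hV, mvfderiv_inner_smul_right hf hW hV,
      inner_comm_fun V Z, inner_comm_fun V W,
      VectorField.mlieBracket_smul_left hf hV, VectorField.mlieBracket_smul_left hf hV]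
    simp [inner_add_left, inner_smul_left, inner_smul_right]
    rw [real_inner_comm (V x) (W x), real_inner_comm (V x) (Z x)]
    ring
  add {V V'} hV hV' := by
    simp only [koszul]
    rw [inner_comm_fun (V + V') Z, inner_comm_fun (V + V') W,
      mvfderiv_inner_add_right hZ hV hV', mvfderiv_inner_add_right hW hV hV',
      inner_comm_fun V Z, inner_comm_fun V W, inner_comm_fun V' Z, inner_comm_fun V' W,
      VectorField.mlieBracket_add_left hV hV', VectorField.mlieBracket_add_left hV hV']
    simp [inner_add_left, inner_add_right]
    ring

theorem koszul_add (hW : MDiffAt (T% W) x) (hW' : MDiffAt (T% W') x)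
    (hV : MDiffAt (T% V) x) (hZ : MDiffAt (T% Z) x) :
    koszul (W + W') V Z x = koszul W V Z x + koszul W' V Z x := by
  simp only [koszul]
  rw [inner_comm_fun (W + W') Z, mvfderiv_inner_add_right hZ hW hW',
    mvfderiv_inner_add_right hV hW hW', inner_comm_fun Z W, inner_comm_fun Z W',
    VectorField.mlieBracket_add_left hW hW', VectorField.mlieBracket_add_right hW hW']
  simp [inner_add_left, inner_add_right]
  ring

theorem koszul_smul (hf : MDiffAt f x) (hW : MDiffAt (T% W) x)
    (hV : MDiffAt (T% V) x) (hZ : MDiffAt (T% Z) x) :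
    koszul (f • W) V Z x =
      f x * koszul W V Z x + mvfderiv 𝓘(ℝ, E) f x (V x) * inner ℝ (W x) (Z x) := by
  simp only [koszul]
  rw [inner_comm_fun (f • W) Z, mvfderiv_inner_smul_right hf hZ hW,
    mvfderiv_inner_smul_right hf hV hW, inner_comm_fun Z W,
    VectorField.mlieBracket_smul_left hf hW, VectorField.mlieBracket_smul_right hf hW]
  simp [inner_add_left, inner_smul_left, inner_smul_right]
  rw [real_inner_comm (W x) (Z x), real_inner_comm (W x) (V x)]
  ring

end Koszul

section LeviCivita

variable {E : Type*} [NormedAddCommGroup E] [NormedSpace ℝ E] [FiniteDimensional ℝ E]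
  {X : Type*} [TopologicalSpace X] [ChartedSpace E X] [IsManifold 𝓘(ℝ, E) ∞ X]
  [RiemannianBundle (fun x : X => TangentSpace 𝓘(ℝ, E) x)]
  [IsContMDiffRiemannianBundle 𝓘(ℝ, E) ∞ E (fun x : X => TangentSpace 𝓘(ℝ, E) x)]
variable {W V Z W' V' Z' : Π x : X, TangentSpace 𝓘(ℝ, E) x} {x : X} {f : X → ℝ}

instance : FiniteDimensional ℝ (TangentSpace 𝓘(ℝ, E) x) := inferInstanceAs (FiniteDimensional ℝ E)

/-- The tangent vector that represents a cotangent vector through the Riemannian metric. -/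
noncomputable def riesz (x : X) (l : TangentSpace 𝓘(ℝ, E) x →L[ℝ] ℝ) : TangentSpace 𝓘(ℝ, E) x :=
  haveI : CompleteSpace (TangentSpace 𝓘(ℝ, E) x) := FiniteDimensional.complete ℝ _
  (InnerProductSpace.toDual ℝ (TangentSpace 𝓘(ℝ, E) x)).symm l

theorem inner_riesz (l : TangentSpace 𝓘(ℝ, E) x →L[ℝ] ℝ) (v : TangentSpace 𝓘(ℝ, E) x) :
    inner ℝ (riesz x l) v = l v :=
  haveI : CompleteSpace (TangentSpace 𝓘(ℝ, E) x) := FiniteDimensional.complete ℝ _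
  InnerProductSpace.toDual_symm_apply

open Classical in
/-- `leviCivitaFun W x v = ∇_v W`, the vector at `x` whose inner product with `Z x` is given by the
Koszul formula (and `0` if the vector field `W` is not differentiable at `x`). -/
noncomputable def leviCivitaFun (W : Π x : X, TangentSpace 𝓘(ℝ, E) x) (x : X) :
    TangentSpace 𝓘(ℝ, E) x →L[ℝ] TangentSpace 𝓘(ℝ, E) x :=
  haveI : CompleteSpace E := FiniteDimensional.complete ℝ E
  if hW : MDiffAt (T% W) x then
    LinearMap.toContinuousLinearMap
      { toFun := fun v => riesz x (TensorialAt.mkHom₂ (fun V Z => koszul W V Z x) x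
          (fun _ hZ => tensorialAt_koszul_left hW hZ)
          (fun _ hV => tensorialAt_koszul_right hW hV) v)
        map_add' := fun v w => by
          refine ext_inner_right ℝ fun u => ?_
          simp [inner_add_left, inner_riesz]
        map_smul' := fun c v => by
          refine ext_inner_right ℝ fun u => ?_
          simp [inner_smul_left, inner_riesz] }
  else 0

theorem inner_leviCivitaFun (hW : MDiffAt (T% W) x) (hV : MDiffAt (T% V) x)
    (hZ : MDiffAt (T% Z) x) :
    inner ℝ (leviCivitaFun W x (V x)) (Z x) = koszul W V Z x := by
  haveI : CompleteSpace E := FiniteDimensional.complete ℝ E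
  simp only [leviCivitaFun, hW, dif_pos]
  refine (inner_riesz _ _).trans ?_
  exact TensorialAt.mkHom₂_apply _ _ hV hZ

theorem mem_ext {u w : TangentSpace 𝓘(ℝ, E) x}
    (h : ∀ Z : Π x : X, TangentSpace 𝓘(ℝ, E) x, MDiffAt (T% Z) x →
      (inner ℝ u (Z x) : ℝ) = inner ℝ w (Z x)) : u = w := by
  refine ext_inner_right ℝ fun v => ?_
  simpa using h (FiberBundle.extend E v) (FiberBundle.mdifferentiableAt_extend ..)

variable (E X) in
/-- The Levi-Civita connection of the Riemannian manifold `X`; `leviCivita E X W x v = ∇_v W`. -/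
noncomputable def leviCivita :
    CovariantDerivative 𝓘(ℝ, E) E (fun x : X => TangentSpace 𝓘(ℝ, E) x) where
  toFun := leviCivitaFun
  isCovariantDerivativeOnUniv :=
    { add := fun {W W' x} hW hW' _ => by
        haveI : CompleteSpace E := FiniteDimensional.complete ℝ E
        ext1 v
        refine mem_ext fun Z hZ => ?_
        have hV : MDiffAt (T% (FiberBundle.extend E v)) x := FiberBundle.mdifferentiableAt_extend ..
        have hv : v = FiberBundle.extend E v x := by simp
        have hWW : MDiffAt (T% (W + W')) x := mdifferentiableAt_add_section hW hW'
        rw [hv, add_apply, inner_add_left, inner_leviCivitaFun hWW hV hZ,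
          inner_leviCivitaFun hW hV hZ, inner_leviCivitaFun hW' hV hZ, koszul_add hW hW' hV hZ]
      leibniz := fun {W f x} hW hf _ => by
        haveI : CompleteSpace E := FiniteDimensional.complete ℝ E
        ext1 v
        refine mem_ext fun Z hZ => ?_
        have hV : MDiffAt (T% (FiberBundle.extend E v)) x := FiberBundle.mdifferentiableAt_extend ..
        have hv : v = FiberBundle.extend E v x := by simp
        have hWW : MDiffAt (T% (f • W)) x := hf.smul_section hW
        rw [hv, inner_leviCivitaFun hWW hV hZ, koszul_smul hf hW hV hZ,
          ← inner_leviCivitaFun hW hV hZ]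
        simp [inner_add_left, inner_smul_left] }

theorem inner_leviCivita (hW : MDiffAt (T% W) x) (hV : MDiffAt (T% V) x)
    (hZ : MDiffAt (T% Z) x) :
    inner ℝ (leviCivita E X W x (V x)) (Z x) = koszul W V Z x :=
  inner_leviCivitaFun hW hV hZ

/-- The Levi-Civita connection is torsion-free. -/
theorem leviCivita_torsion [CompleteSpace E] : (leviCivita E X).torsion = 0 := by
  rw [CovariantDerivative.torsion_eq_zero_iff]
  intro V W x hV hW
  refine mem_ext fun Z hZ => ?_
  rw [inner_sub_left, inner_leviCivita hW hV hZ, inner_leviCivita hV hW hZ, koszul, koszul,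
    inner_comm_fun W V, VectorField.mlieBracket_swap_apply (V := W) (W := V), inner_neg_left]
  ring

/-- The Levi-Civita connection is compatible with the metric:
`V⟪W, Z⟫ = ⟪∇_V W, Z⟫ + ⟪W, ∇_V Z⟫`. -/
theorem leviCivita_metric (hV : MDiffAt (T% V) x) (hW : MDiffAt (T% W) x)
    (hZ : MDiffAt (T% Z) x) :
    mvfderiv 𝓘(ℝ, E) (fun y => (inner ℝ (W y) (Z y) : ℝ)) x (V x) =
      inner ℝ (leviCivita E X W x (V x)) (Z x) + inner ℝ (W x) (leviCivita E X Z x (V x)) := by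
  rw [real_inner_comm (leviCivita E X Z x (V x)) (W x), inner_leviCivita hW hV hZ,
    inner_leviCivita hZ hV hW, koszul, koszul, inner_comm_fun Z W,
    VectorField.mlieBracket_swap_apply (V := Z) (W := W), inner_neg_left]
  ring

end LeviCivita

section Calibrations

variable {E : Type*} [NormedAddCommGroup E] [NormedSpace ℝ E]
  {X : Type*} [TopologicalSpace X] [ChartedSpace E X] {p : ℕ}

/-! ### Calibrations -/

/-- The coordinate expression of a `p`-form `φ` on `X` in the chart at `x₀`: its pullback by the
inverse of the chart, a `p`-form on (the target of the chart in) the vector space `E`. -/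
noncomputable def formInChart (φ : Π x : X, TangentSpace 𝓘(ℝ, E) x [⋀^Fin p]→L[ℝ] ℝ) (x₀ : X) :
    E → E [⋀^Fin p]→L[ℝ] ℝ := fun y =>
  (φ ((chartAt E x₀).symm y)).compContinuousLinearMap
    (mfderiv 𝓘(ℝ, E) 𝓘(ℝ, E) (chartAt E x₀).symm y)

/-- A `p`-form is smooth if its coordinate expressions are. -/
def IsSmoothForm (φ : Π x : X, TangentSpace 𝓘(ℝ, E) x [⋀^Fin p]→L[ℝ] ℝ) : Prop :=
  ∀ x₀ : X, ContDiffOn ℝ ∞ (formInChart φ x₀) (chartAt E x₀).target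

/-- `dφ = 0`, in all charts. -/
def IsClosedForm (φ : Π x : X, TangentSpace 𝓘(ℝ, E) x [⋀^Fin p]→L[ℝ] ℝ) : Prop :=
  ∀ x₀ : X, ∀ y ∈ (chartAt E x₀).target, extDeriv (formInChart φ x₀) y = 0

variable [RiemannianBundle (fun x : X => TangentSpace 𝓘(ℝ, E) x)]

/-- A calibration: a smooth closed `p`-form with `φ(ξ) ≤ 1` for all unit simple tangent
`p`-vectors `ξ = e₁ ∧ ⋯ ∧ e_p` (with `e` orthonormal). -/
structure IsCalibration (φ : Π x : X, TangentSpace 𝓘(ℝ, E) x [⋀^Fin p]→L[ℝ] ℝ) : Prop where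
  smooth : IsSmoothForm φ
  closed : IsClosedForm φ
  comass_le_one : ∀ (x : X) (e : Fin p → TangentSpace 𝓘(ℝ, E) x), Orthonormal ℝ e → φ x e ≤ 1

/-- The orthonormal frame `e` at `x` represents a `φ`-plane `ξ = e₁ ∧ ⋯ ∧ e_p`, that is, a unit
simple `p`-vector with `φ(ξ) = 1`. -/
def IsPhiPlane (φ : Π x : X, TangentSpace 𝓘(ℝ, E) x [⋀^Fin p]→L[ℝ] ℝ) (x : X)
    (e : Fin p → TangentSpace 𝓘(ℝ, E) x) : Prop :=
  Orthonormal ℝ e ∧ φ x e = 1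

end Calibrations

section Convexity

variable {E : Type*} [NormedAddCommGroup E] [NormedSpace ℝ E] [FiniteDimensional ℝ E]
  {X : Type*} [TopologicalSpace X] [ChartedSpace E X] [IsManifold 𝓘(ℝ, E) ∞ X]
  [RiemannianBundle (fun x : X => TangentSpace 𝓘(ℝ, E) x)]
  [IsContMDiffRiemannianBundle 𝓘(ℝ, E) ∞ E (fun x : X => TangentSpace 𝓘(ℝ, E) x)]
  {p : ℕ}

/-! ### Plurisubharmonic functions -/

/-- The Riemannian gradient. -/
noncomputable def grad (f : X → ℝ) (x : X) : TangentSpace 𝓘(ℝ, E) x :=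
  riesz x (mvfderiv 𝓘(ℝ, E) f x)

/-- The Riemannian Hessian as an endomorphism of the tangent space: `v ↦ ∇_v (∇ f)`. -/
noncomputable def hessian (f : X → ℝ) (x : X) :
    TangentSpace 𝓘(ℝ, E) x →L[ℝ] TangentSpace 𝓘(ℝ, E) x :=
  leviCivita E X (grad f) x

/-- The `φ`-Hessian: the `p`-form obtained by letting the endomorphism `Hess f` act on `φ` as a
derivation, evaluated on `v₁ ∧ ⋯ ∧ v_p`, i.e. `∑ₖ φ(v₁, …, (Hess f) vₖ, …, v_p)`. -/
noncomputable def phiHessian (φ : Π x : X, TangentSpace 𝓘(ℝ, E) x [⋀^Fin p]→L[ℝ] ℝ)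
    (f : X → ℝ) (x : X) (v : Fin p → TangentSpace 𝓘(ℝ, E) x) : ℝ :=
  ∑ k, φ x (Function.update v k (hessian f x (v k)))

/-- `f` is smooth and strictly `φ`-plurisubharmonic on the open set `U`. -/
def IsStrictlyPSHOn (φ : Π x : X, TangentSpace 𝓘(ℝ, E) x [⋀^Fin p]→L[ℝ] ℝ)
    (f : X → ℝ) (U : Set X) : Prop :=
  ContMDiffOn 𝓘(ℝ, E) 𝓘(ℝ, ℝ) ∞ f U ∧
    ∀ x ∈ U, ∀ e : Fin p → TangentSpace 𝓘(ℝ, E) x, IsPhiPlane φ x e → 0 < phiHessian φ f x e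

/-- `(X, φ)` is strictly `φ`-convex: it carries a strictly `φ`-plurisubharmonic proper exhaustion
function. -/
def IsStrictlyConvexManifold (φ : Π x : X, TangentSpace 𝓘(ℝ, E) x [⋀^Fin p]→L[ℝ] ℝ) : Prop :=
  ∃ f : X → ℝ, IsStrictlyPSHOn φ f univ ∧ ∀ c : ℝ, IsCompact {x | f x ≤ c}

/-! ### Boundaries -/

/-- `ρ` is a defining function for `∂Ω` over the open set `U`: it is smooth on `U`,
`Ω ∩ U = {x ∈ U : ρ x < 0}`, and `∇ρ ≠ 0` at the points of `∂Ω` in `U`. -/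
structure IsDefiningFunctionOn (Ω : Set X) (ρ : X → ℝ) (U : Set X) : Prop where
  isOpen : IsOpen U
  smooth : ContMDiffOn 𝓘(ℝ, E) 𝓘(ℝ, ℝ) ∞ ρ U
  mem_iff : ∀ x ∈ U, x ∈ Ω ↔ ρ x < 0
  grad_ne_zero : ∀ x ∈ U ∩ frontier Ω, grad (E := E) ρ x ≠ 0

variable (E) in
/-- A (global) defining function for `∂Ω`: a defining function over a neighborhood of the closure
of `Ω`. -/
def IsDefiningFunction (Ω : Set X) (ρ : X → ℝ) : Prop :=
  ∃ U : Set X, closure Ω ⊆ U ∧ IsDefiningFunctionOn (E := E) Ω ρ U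

variable (E) in
/-- `Ω` is open with smooth boundary: near each of its boundary points it is the sublevel set of a
smooth function with nonvanishing gradient. -/
def HasSmoothBoundary (Ω : Set X) : Prop :=
  IsOpen Ω ∧ ∀ x ∈ frontier Ω, ∃ (ρ : X → ℝ) (U : Set X),
    x ∈ U ∧ IsDefiningFunctionOn (E := E) Ω ρ U

/-- `v` belongs to `T_x ∂Ω`, the kernel of `dρ` at `x` for a local defining function `ρ` (it does
not depend on `ρ`). -/
def IsTangentToBoundary (Ω : Set X) (x : X) (v : TangentSpace 𝓘(ℝ, E) x) : Prop :=
  ∃ (ρ : X → ℝ) (U : Set X), x ∈ U ∧ IsDefiningFunctionOn (E := E) Ω ρ U ∧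
    mvfderiv 𝓘(ℝ, E) ρ x v = 0

/-- The frame `e` at `x` represents a tangential `φ`-plane `ξ`: `span ξ ⊆ T_x ∂Ω`. -/
def IsTangentialPhiPlane (φ : Π x : X, TangentSpace 𝓘(ℝ, E) x [⋀^Fin p]→L[ℝ] ℝ) (Ω : Set X)
    (x : X) (e : Fin p → TangentSpace 𝓘(ℝ, E) x) : Prop :=
  IsPhiPlane φ x e ∧ ∀ k, IsTangentToBoundary Ω x (e k)

/-- `∂Ω` is strictly `φ`-convex: for a defining function `ρ`, the `φ`-Hessian of `ρ` is positive on
all tangential `φ`-planes (this does not depend on the choice of `ρ`). -/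
def IsStrictlyConvexBoundary (φ : Π x : X, TangentSpace 𝓘(ℝ, E) x [⋀^Fin p]→L[ℝ] ℝ)
    (Ω : Set X) : Prop :=
  ∃ ρ : X → ℝ, IsDefiningFunction E Ω ρ ∧
    ∀ x ∈ frontier Ω, ∀ e : Fin p → TangentSpace 𝓘(ℝ, E) x,
      IsTangentialPhiPlane φ Ω x e → 0 < phiHessian φ ρ x e

/-- `n` is the outward-pointing unit normal `∇ρ / |∇ρ|` of `∂Ω` at `x`, where `ρ` is a local
defining function. -/
def IsOutwardUnitNormal (Ω : Set X) (x : X) (n : TangentSpace 𝓘(ℝ, E) x) : Prop :=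
  ∃ (ρ : X → ℝ) (U : Set X), x ∈ U ∧ IsDefiningFunctionOn (E := E) Ω ρ U ∧
    n = ‖grad (E := E) ρ x‖⁻¹ • grad ρ x

open Classical in
/-- The outward-pointing unit normal of `∂Ω` at `x` (it is unique; `0` if there is none). -/
noncomputable def outwardNormal (Ω : Set X) (x : X) : TangentSpace 𝓘(ℝ, E) x :=
  if h : ∃ n, IsOutwardUnitNormal Ω x n then h.choose else 0

/-- `W` is a vector field that is smooth near `x`, tangent to `∂Ω` along `∂Ω` near `x`, and has the
value `w` at `x`. -/
def IsTangentExtension (Ω : Set X) (x : X) (w : TangentSpace 𝓘(ℝ, E) x)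
    (W : Π y : X, TangentSpace 𝓘(ℝ, E) y) : Prop :=
  W x = w ∧ ∃ U : Set X, IsOpen U ∧ x ∈ U ∧
    ContMDiffOn 𝓘(ℝ, E) (𝓘(ℝ, E).prod 𝓘(ℝ, E)) ∞ (T% W) U ∧
    ∀ y ∈ U ∩ frontier Ω, IsTangentToBoundary Ω y (W y)

open Classical in
/-- The second fundamental form of `∂Ω` with respect to the outward-pointing unit normal `n`:
`II(v, w) = ⟪∇_v W, n⟫`, where `W` extends `w ∈ T_x ∂Ω` to a vector field tangent to `∂Ω` (the value
does not depend on the extension; `0` if there is none). Since `n` is normal to `∂Ω`, this is the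
inner product of `n` with the normal component of `∇_v W`. -/
noncomputable def secondFundamentalForm (Ω : Set X) (x : X) (v w : TangentSpace 𝓘(ℝ, E) x) : ℝ :=
  if h : ∃ W, IsTangentExtension Ω x w W then
    inner ℝ (leviCivita E X h.choose x v) (outwardNormal Ω x)
  else 0

/-- The trace of the second fundamental form of `∂Ω` on the span of the orthonormal frame `e`. -/
noncomputable def traceSecondFundamentalForm (Ω : Set X) (x : X)
    (e : Fin p → TangentSpace 𝓘(ℝ, E) x) : ℝ :=
  ∑ k, secondFundamentalForm Ω x (e k) (e k)

end Convexity

end CalibratedGeometry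

/-!
The form `φ` enters only through the set of `φ`-planes. Indeed, `φ` attains its comass `1` at a
`φ`-plane `ξ = e₁ ∧ ⋯ ∧ e_p`, so its first variation there vanishes and
`φ(e₁, …, w, …, e_p) = ⟪w, e_k⟫` with `w` in the slot `k` (`apply_update_of_maximal`). Hence
`ℋ^φ(f)(ξ)` is the trace of the Riemannian Hessian of `f` over `ξ` (`IsPhiPlane.phiHessian_eq`).

*Convexity and the second fundamental form.* Let `ρ` be a defining function and `W` a vector field
tangent to the boundary. The function `⟪W, ∇ρ⟫` vanishes on the boundary, so its differential kills
tangent vectors `v` (`mvfderiv_eq_zero_of_eq_zero`, by Lagrange multipliers). Metric compatibility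
of the Levi-Civita connection turns this into `II(v, w) = -⟪∇_v ∇ρ, w⟫ / |∇ρ|`
(`IsDefiningFunctionOn.secondFundamentalForm_eq`). Negativity of the trace of `II` is therefore the
same as positivity of the `φ`-Hessian of any defining function, and a global one exists by a
partition of unity (`HasSmoothBoundary.exists_global`).

*A strictly plurisubharmonic defining function.* Let `ρ` satisfy the convexity condition on the
tangential `φ`-planes, and let `f ≤ 0` on `closure Ω` be strictly plurisubharmonic. The `φ`-planes
over a compact set form a compact set, so `tr_ξ (Hess ρ + C dρ ⊗ dρ) > 0` for all `φ`-planes `ξ`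
near the boundary if `C` is large (`exists_hessianTrace_add_pos`). If `η'' ≥ C η'` and `η' ≥ 0`
vanishes exactly to the left of `-δ`, with `δ` small, then `η(ρ)` is plurisubharmonic on all of
`closure Ω` and strictly so where `ρ > -δ`. The function `K η(ρ) + χ(ρ) f`, with a cutoff `χ` that
is `1` to the left of `-δ / 2` and `0` near the boundary, is then strictly plurisubharmonic on
`closure Ω` for large `K`: where `ρ < -δ / 2` the second summand is `f`, and on the remaining
compact collar the first summand dominates. It is a positive multiple of `η(ρ)` near the boundary,
so it is again a defining function (`exists_strictlyPSH_definingFunction`).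
-/

namespace CalibratedGeometry

open Filter

/-! ### Differentials and coordinate vector fields -/

section Calculus

variable {E : Type*} [NormedAddCommGroup E] [NormedSpace ℝ E]
  {X : Type*} [TopologicalSpace X] [ChartedSpace E X]

theorem contMDiffOn_mvfderiv_apply [IsManifold 𝓘(ℝ, E) ∞ X] {f : X → ℝ} {U : Set X}
    (hU : IsOpen U) (hf : ContMDiffOn 𝓘(ℝ, E) 𝓘(ℝ, ℝ) ∞ f U) {V : Π x : X, TangentSpace 𝓘(ℝ, E) x}
    (hV : ContMDiffOn 𝓘(ℝ, E) (𝓘(ℝ, E).prod 𝓘(ℝ, E)) ∞ (T% V) U) :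
    ContMDiffOn 𝓘(ℝ, E) 𝓘(ℝ, ℝ) ∞ (fun y => mvfderiv 𝓘(ℝ, E) f y (V y)) U := by
  have h1 := hf.contMDiffOn_tangentMapWithin (m := ∞) (by simp) hU.uniqueMDiffOn
  have h2 := h1.comp hV (fun y hy => hy)
  have h3 := (contMDiff_snd_tangentBundle_modelSpace (n := ∞) ℝ 𝓘(ℝ, ℝ)).comp_contMDiffOn h2
  refine h3.congr fun y hy => ?_
  change mfderiv 𝓘(ℝ, E) 𝓘(ℝ, ℝ) f y (V y) = mfderivWithin 𝓘(ℝ, E) 𝓘(ℝ, ℝ) f U y (V y)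
  rw [mfderivWithin_of_isOpen hU hy]

variable (E) in
/-- The vector field near `x₀` with constant components `u` in the chart at `x₀` (and junk value
`0` off the domain of that chart). -/
noncomputable def coordField (x₀ : X) [IsManifold 𝓘(ℝ, E) 1 X] (u : E) (x : X) :
    TangentSpace 𝓘(ℝ, E) x :=
  (trivializationAt E (TangentSpace 𝓘(ℝ, E)) x₀).symmL ℝ x u

variable [IsManifold 𝓘(ℝ, E) ∞ X]

theorem coordField_sum {ι : Type*} (s : Finset ι) (x₀ x : X) (c : ι → ℝ) (u : ι → E) :
    coordField E x₀ (∑ i ∈ s, c i • u i) x = ∑ i ∈ s, c i • coordField E x₀ (u i) x := by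
  simp [coordField, map_sum]

theorem contMDiffOn_coordField (x₀ : X) (u : E) :
    ContMDiffOn 𝓘(ℝ, E) (𝓘(ℝ, E).prod 𝓘(ℝ, E)) ∞ (T% (coordField E x₀ u))
      (chartAt E x₀).source := by
  have := (trivializationAt E (TangentSpace 𝓘(ℝ, E)) x₀).contMDiffOn_section_baseSet_iff
    (IB := 𝓘(ℝ, E)) (n := ∞) (s := coordField E x₀ u)
  rw [TangentBundle.trivializationAt_baseSet] at this
  rw [this]
  apply (contMDiffOn_const (c := u)).congr
  intro y hy
  have hy' : y ∈ (trivializationAt E (TangentSpace 𝓘(ℝ, E)) x₀).baseSet := by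
    simpa using hy
  have h := (trivializationAt E (TangentSpace 𝓘(ℝ, E)) x₀).continuousLinearMapAt_symmL
    (R := ℝ) hy' u
  rwa [Trivialization.continuousLinearMapAt_apply, Trivialization.linearMapAt_apply,
    if_pos hy'] at h

theorem coordField_continuousLinearMapAt {x₀ x : X} (hx : x ∈ (chartAt E x₀).source)
    (v : TangentSpace 𝓘(ℝ, E) x) :
    coordField E x₀ ((trivializationAt E (TangentSpace 𝓘(ℝ, E)) x₀).continuousLinearMapAt ℝ x v) x
      = v := by
  have hy' : x ∈ (trivializationAt E (TangentSpace 𝓘(ℝ, E)) x₀).baseSet := by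
    simpa using hx
  exact (trivializationAt E (TangentSpace 𝓘(ℝ, E)) x₀).symmL_continuousLinearMapAt hy' v

theorem exists_coordField_eq {x₀ x : X} (hx : x ∈ (chartAt E x₀).source)
    (v : TangentSpace 𝓘(ℝ, E) x) : ∃ u : E, coordField E x₀ u x = v :=
  ⟨_, coordField_continuousLinearMapAt hx v⟩

theorem coordField_injective {x₀ x : X} (hx : x ∈ (chartAt E x₀).source) :
    Function.Injective fun u => coordField E x₀ u x := by
  intro u u' h
  have hy' : x ∈ (trivializationAt E (TangentSpace 𝓘(ℝ, E)) x₀).baseSet := by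
    simpa using hx
  have h' := congrArg
    ((trivializationAt E (TangentSpace 𝓘(ℝ, E)) x₀).continuousLinearMapAt ℝ x) h
  simpa only [coordField, Trivialization.continuousLinearMapAt_symmL _ hy'] using h'

end Calculus

/-! ### Smoothness of the gradient -/

section Gradient

variable {E : Type*} [NormedAddCommGroup E] [NormedSpace ℝ E] [FiniteDimensional ℝ E]
  {X : Type*} [TopologicalSpace X] [ChartedSpace E X] [IsManifold 𝓘(ℝ, E) ∞ X]
  [RiemannianBundle (fun x : X => TangentSpace 𝓘(ℝ, E) x)]
  [IsContMDiffRiemannianBundle 𝓘(ℝ, E) ∞ E (fun x : X => TangentSpace 𝓘(ℝ, E) x)]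

theorem inner_grad (f : X → ℝ) (x : X) (v : TangentSpace 𝓘(ℝ, E) x) :
    inner ℝ (grad f x) v = mvfderiv 𝓘(ℝ, E) f x v :=
  inner_riesz _ _

theorem inner_grad' (f : X → ℝ) (x : X) (v : TangentSpace 𝓘(ℝ, E) x) :
    inner ℝ v (grad f x) = mvfderiv 𝓘(ℝ, E) f x v := by
  rw [real_inner_comm, inner_grad]

theorem grad_eq_zero_iff {f : X → ℝ} {x : X} :
    grad (E := E) f x = 0 ↔ mvfderiv 𝓘(ℝ, E) f x = 0 := by
  constructor
  · intro h
    ext v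
    rw [← inner_grad, h, inner_zero_left]
    rfl
  · intro h
    rw [← inner_self_eq_zero (𝕜 := ℝ), inner_grad, h]
    rfl

theorem contMDiffOn_inner {V W : Π x : X, TangentSpace 𝓘(ℝ, E) x} {U : Set X}
    (hV : ContMDiffOn 𝓘(ℝ, E) (𝓘(ℝ, E).prod 𝓘(ℝ, E)) ∞ (T% V) U)
    (hW : ContMDiffOn 𝓘(ℝ, E) (𝓘(ℝ, E).prod 𝓘(ℝ, E)) ∞ (T% W) U) :
    ContMDiffOn 𝓘(ℝ, E) 𝓘(ℝ, ℝ) ∞ (fun y => (inner ℝ (V y) (W y) : ℝ)) U :=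
  ContMDiffOn.inner_bundle (E := fun x : X => TangentSpace 𝓘(ℝ, E) x) hV hW

/-- In a coordinate frame, the components of `∇f` are obtained by applying the inverse of the Gram
matrix, which is a smooth function of the point, to the components of `df`. -/
theorem contMDiffOn_grad {f : X → ℝ} {U : Set X} (hU : IsOpen U)
    (hf : ContMDiffOn 𝓘(ℝ, E) 𝓘(ℝ, ℝ) ∞ f U) :
    ContMDiffOn 𝓘(ℝ, E) (𝓘(ℝ, E).prod 𝓘(ℝ, E)) ∞ (T% (grad (E := E) f)) U := by
  intro x₀ hx₀
  apply ContMDiffAt.contMDiffWithinAt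
  let b := Module.finBasis ℝ E
  let ι := Fin (Module.finrank ℝ E)
  let A := (ι → ℝ) →L[ℝ] (ι → ℝ)
  let F : ι → Π x : X, TangentSpace 𝓘(ℝ, E) x := fun i => coordField E x₀ (b i)
  set S := (chartAt E x₀).source ∩ U with hS
  have hSo : IsOpen S := (chartAt E x₀).open_source.inter hU
  have hx₀S : x₀ ∈ S := ⟨mem_chart_source E x₀, hx₀⟩
  have hF : ∀ i, ContMDiffOn 𝓘(ℝ, E) (𝓘(ℝ, E).prod 𝓘(ℝ, E)) ∞ (T% (F i)) S :=
    fun i => (contMDiffOn_coordField x₀ (b i)).mono inter_subset_left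
  -- the Gram matrix of the coordinate frame, as an operator
  let M : ι → ι → A := fun i j =>
    (ContinuousLinearMap.proj (R := ℝ) (φ := fun _ : ι => ℝ) j).smulRight (Pi.single i (1 : ℝ))
  have hM : ∀ i j c k, M i j c k = if k = i then c j else 0 := by
    intro i j c k
    change c j * (Pi.single i (1 : ℝ) : ι → ℝ) k = _
    simp [Pi.single_apply]
  let G : X → A := fun x => ∑ i, ∑ j, (inner ℝ (F i x) (F j x) : ℝ) • M i j
  have hG : ContMDiffOn 𝓘(ℝ, E) 𝓘(ℝ, A) ∞ G S :=
    contMDiffOn_finsetSum fun i _ => contMDiffOn_finsetSum fun j _ =>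
      (contMDiffOn_inner (hF i) (hF j)).smul contMDiffOn_const
  have hGapp : ∀ x c i, G x c i = inner ℝ (F i x) (∑ j, c j • F j x) := by
    intro x c i
    have h : G x c i = ∑ k, ∑ j, (inner ℝ (F k x) (F j x) : ℝ) * M k j c i := by
      simp [G]
    rw [h]
    simp [hM, inner_sum, inner_smul_right, mul_comm]
  have hinj : ∀ x ∈ S, IsUnit (G x) := by
    intro x hx
    rw [ContinuousLinearMap.isUnit_iff_isUnit_toLinearMap, LinearMap.isUnit_iff_ker_eq_bot,
      LinearMap.ker_eq_bot']
    intro c hc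
    have h0 : (∑ j, c j • F j x) = 0 := by
      rw [← inner_self_eq_zero (𝕜 := ℝ), sum_inner]
      refine Finset.sum_eq_zero fun i _ => ?_
      rw [inner_smul_left, ← hGapp]
      simp only [ContinuousLinearMap.coe_coe] at hc
      simp [hc]
    have h1 : (∑ j, c j • b j) = 0 := by
      apply coordField_injective hx.1
      simp only [coordField_sum]
      rw [h0]
      simp [coordField]
    funext j
    exact Fintype.linearIndependent_iff.1 b.linearIndependent c h1 j
  let d : X → (ι → ℝ) := fun x i => mvfderiv 𝓘(ℝ, E) f x (F i x)
  have hd : ContMDiffOn 𝓘(ℝ, E) 𝓘(ℝ, ι → ℝ) ∞ d S :=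
    contMDiffOn_pi_space.2 fun i =>
      contMDiffOn_mvfderiv_apply hSo (hf.mono inter_subset_right) (hF i)
  let c : X → (ι → ℝ) := fun x => Ring.inverse (G x) (d x)
  have hc : ContMDiffAt 𝓘(ℝ, E) 𝓘(ℝ, ι → ℝ) ∞ c x₀ := by
    have hGi : ContMDiffAt 𝓘(ℝ, E) 𝓘(ℝ, A) ∞ (fun x => Ring.inverse (G x)) x₀ := by
      obtain ⟨a, ha⟩ := hinj x₀ hx₀S
      have h1 : ContDiffAt ℝ ∞ Ring.inverse (G x₀) := ha ▸ contDiffAt_ringInverse ℝ a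
      exact h1.contMDiffAt.comp x₀ (hG.contMDiffAt (hSo.mem_nhds hx₀S))
    exact hGi.clm_apply (hd.contMDiffAt (hSo.mem_nhds hx₀S))
  have hci : ∀ i, ContMDiffAt 𝓘(ℝ, E) 𝓘(ℝ, ℝ) ∞ (fun x => c x i) x₀ := by
    exact contMDiffAt_pi_space.1 hc
  have hsum : ContMDiffAt 𝓘(ℝ, E) (𝓘(ℝ, E).prod 𝓘(ℝ, E)) ∞
      (T% (fun x => ∑ i, c x i • F i x)) x₀ :=
    ContMDiffAt.sum_section fun i _ =>
      (hci i).smul_section ((hF i).contMDiffAt (hSo.mem_nhds hx₀S))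
  refine hsum.congr_of_eventuallyEq ?_
  filter_upwards [hSo.mem_nhds hx₀S] with x hx
  have hkey : grad (E := E) f x = ∑ i, c x i • F i x := by
    have hGc : G x (c x) = d x := by
      have := Ring.mul_inverse_cancel (G x) (hinj x hx)
      exact congrArg (fun a : A => a (d x)) this
    refine ext_inner_left ℝ fun v => ?_
    obtain ⟨u, rfl⟩ := exists_coordField_eq hx.1 v
    rw [← b.sum_repr u, coordField_sum, sum_inner, sum_inner]
    refine Finset.sum_congr rfl fun i _ => ?_
    rw [inner_smul_left, inner_smul_left, inner_grad']
    congr 1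
    rw [← hGapp, hGc]
  simp [hkey]

end Gradient

/-! ### The chain rule for the Hessian -/

section Hessian

variable {E : Type*} [NormedAddCommGroup E] [NormedSpace ℝ E] [FiniteDimensional ℝ E]
  {X : Type*} [TopologicalSpace X] [ChartedSpace E X] [IsManifold 𝓘(ℝ, E) ∞ X]
  [RiemannianBundle (fun x : X => TangentSpace 𝓘(ℝ, E) x)]
  [IsContMDiffRiemannianBundle 𝓘(ℝ, E) ∞ E (fun x : X => TangentSpace 𝓘(ℝ, E) x)]
  {f g : X → ℝ} {U : Set X} {x : X}

theorem mdifferentiableAt_of_contMDiffOn (hU : IsOpen U) (hx : x ∈ U)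
    (hf : ContMDiffOn 𝓘(ℝ, E) 𝓘(ℝ, ℝ) ∞ f U) : MDiffAt f x :=
  (hf.contMDiffAt (hU.mem_nhds hx)).mdifferentiableAt (by simp)

theorem mdifferentiableAt_grad (hU : IsOpen U) (hx : x ∈ U)
    (hf : ContMDiffOn 𝓘(ℝ, E) 𝓘(ℝ, ℝ) ∞ f U) : MDiffAt (T% (grad (E := E) f)) x :=
  ((contMDiffOn_grad hU hf).contMDiffAt (hU.mem_nhds hx)).mdifferentiableAt (by simp)

theorem grad_congr (h : f =ᶠ[𝓝 x] g) : grad (E := E) f x = grad g x := by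
  simp only [grad, mvfderiv, h.mfderiv_eq]
  rw [h.eq_of_nhds]

theorem hessian_congr (hU : IsOpen U) (hx : x ∈ U)
    (hf : ContMDiffOn 𝓘(ℝ, E) 𝓘(ℝ, ℝ) ∞ f U) (hg : ContMDiffOn 𝓘(ℝ, E) 𝓘(ℝ, ℝ) ∞ g U)
    (h : f =ᶠ[𝓝 x] g) : hessian (E := E) f x = hessian g x := by
  refine (leviCivita E X).isCovariantDerivativeOnUniv.congr_of_eventuallyEq
    (mdifferentiableAt_grad hU hx hf) (mdifferentiableAt_grad hU hx hg) univ_mem ?_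
  filter_upwards [h.eventuallyEq_nhds] with y hy using grad_congr hy

theorem grad_add (hU : IsOpen U) (hx : x ∈ U)
    (hf : ContMDiffOn 𝓘(ℝ, E) 𝓘(ℝ, ℝ) ∞ f U) (hg : ContMDiffOn 𝓘(ℝ, E) 𝓘(ℝ, ℝ) ∞ g U) :
    grad (E := E) (f + g) x = grad f x + grad g x := by
  refine ext_inner_right ℝ fun v => ?_
  rw [inner_add_left, inner_grad, inner_grad, inner_grad,
    mvfderiv_add (mdifferentiableAt_of_contMDiffOn hU hx hf)
      (mdifferentiableAt_of_contMDiffOn hU hx hg)]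
  rfl

theorem hessian_add (hU : IsOpen U) (hx : x ∈ U)
    (hf : ContMDiffOn 𝓘(ℝ, E) 𝓘(ℝ, ℝ) ∞ f U) (hg : ContMDiffOn 𝓘(ℝ, E) 𝓘(ℝ, ℝ) ∞ g U) :
    hessian (E := E) (f + g) x = hessian f x + hessian g x := by
  have hfg := hf.add hg
  refine Eq.trans ((leviCivita E X).isCovariantDerivativeOnUniv.congr_of_eventuallyEq
    (σ' := grad f + grad g) (mdifferentiableAt_grad hU hx hfg)
    (mdifferentiableAt_add_section (mdifferentiableAt_grad hU hx hf)
      (mdifferentiableAt_grad hU hx hg)) univ_mem ?_)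
    ((leviCivita E X).isCovariantDerivativeOnUniv.add (mdifferentiableAt_grad hU hx hf)
      (mdifferentiableAt_grad hU hx hg))
  filter_upwards [hU.mem_nhds hx] with y hy using grad_add hU hy hf hg

theorem mvfderiv_real_comp {η : ℝ → ℝ} {ρ : X → ℝ} (hη : DifferentiableAt ℝ η (ρ x))
    (hρ : MDiffAt ρ x) (v : TangentSpace 𝓘(ℝ, E) x) :
    mvfderiv 𝓘(ℝ, E) (fun y => η (ρ y)) x v =
      deriv η (ρ x) * mvfderiv 𝓘(ℝ, E) ρ x v := by
  refine (mvfderiv_comp_apply (g := η) (f := ρ) x hη.mdifferentiableAt hρ v).trans ?_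
  change mfderiv 𝓘(ℝ, ℝ) 𝓘(ℝ, ℝ) η (ρ x) (mfderiv 𝓘(ℝ, E) 𝓘(ℝ, ℝ) ρ x v) = _
  rw [mfderiv_eq_fderiv]
  exact (fderiv_eq_smul_deriv (f := η) _).trans (mul_comm _ _)

theorem grad_comp {η : ℝ → ℝ} {ρ : X → ℝ} (hη : DifferentiableAt ℝ η (ρ x))
    (hρ : MDiffAt ρ x) :
    grad (E := E) (fun y => η (ρ y)) x = deriv η (ρ x) • grad ρ x := by
  refine ext_inner_right ℝ fun v => ?_
  rw [inner_smul_left, inner_grad, inner_grad, mvfderiv_real_comp hη hρ]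
  rfl

/-- The chain rule `Hess (η ∘ ρ) = η'(ρ) Hess ρ + η''(ρ) dρ ⊗ dρ`, on the diagonal. -/
theorem inner_hessian_comp {η : ℝ → ℝ} {ρ : X → ℝ} (hη : ContDiff ℝ ∞ η) (hU : IsOpen U)
    (hx : x ∈ U) (hρ : ContMDiffOn 𝓘(ℝ, E) 𝓘(ℝ, ℝ) ∞ ρ U) (v : TangentSpace 𝓘(ℝ, E) x) :
    inner ℝ (hessian (E := E) (fun y => η (ρ y)) x v) v =
      deriv η (ρ x) * inner ℝ (hessian ρ x v) v +
        deriv (deriv η) (ρ x) * mvfderiv 𝓘(ℝ, E) ρ x v ^ 2 := by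
  have hη1 : ContDiff ℝ ∞ (deriv η) := (contDiff_infty_iff_deriv.1 hη).2
  have hd : ContMDiffOn 𝓘(ℝ, E) 𝓘(ℝ, ℝ) ∞ (fun y => deriv η (ρ y)) U :=
    hη1.contMDiff.comp_contMDiffOn hρ
  have hηρ : ContMDiffOn 𝓘(ℝ, E) 𝓘(ℝ, ℝ) ∞ (fun y => η (ρ y)) U :=
    hη.contMDiff.comp_contMDiffOn hρ
  have hg := mdifferentiableAt_grad hU hx hρ
  have hdx := mdifferentiableAt_of_contMDiffOn hU hx hd
  have h1 : hessian (E := E) (fun y => η (ρ y)) x =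
      leviCivita E X ((fun y => deriv η (ρ y)) • grad ρ) x := by
    refine (leviCivita E X).isCovariantDerivativeOnUniv.congr_of_eventuallyEq
      (mdifferentiableAt_grad hU hx hηρ) (hdx.smul_section hg) univ_mem ?_
    filter_upwards [hU.mem_nhds hx] with y hy using
      grad_comp (hη.differentiable (by simp) _) (mdifferentiableAt_of_contMDiffOn hU hy hρ)
  have h2 := (leviCivita E X).isCovariantDerivativeOnUniv.leibniz hg hdx
  rw [h1, h2]
  have h3 : mvfderiv 𝓘(ℝ, E) (fun y => deriv η (ρ y)) x v =
      deriv (deriv η) (ρ x) * mvfderiv 𝓘(ℝ, E) ρ x v :=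
    mvfderiv_real_comp (hη1.differentiable (by simp) _)
      (mdifferentiableAt_of_contMDiffOn hU hx hρ) v
  change inner ℝ (deriv η (ρ x) • hessian ρ x v +
    (mvfderiv 𝓘(ℝ, E) (fun y => deriv η (ρ y)) x v) • grad ρ x) v = _
  rw [h3, inner_add_left, inner_smul_left, inner_smul_left, inner_grad]
  simp only [conj_trivial]
  ring

theorem hessian_const_mul (c : ℝ) (hU : IsOpen U) (hx : x ∈ U)
    (hf : ContMDiffOn 𝓘(ℝ, E) 𝓘(ℝ, ℝ) ∞ f U) (v : TangentSpace 𝓘(ℝ, E) x) :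
    inner ℝ (hessian (E := E) (fun y => c * f y) x v) v = c * inner ℝ (hessian f x v) v := by
  have h := inner_hessian_comp (η := fun t => c * t) (by fun_prop) hU hx hf v
  have h1 : deriv (fun t : ℝ => c * t) = fun _ => c := by
    ext t; simp
  simpa [h1] using h

/-! ### The trace of the Hessian over a frame -/

variable {p : ℕ}

/-- The trace of the quadratic form `v ↦ ⟪∇_v ∇f, v⟫` on the frame `e`. -/
noncomputable def hessianTrace (f : X → ℝ) (x : X) (e : Fin p → TangentSpace 𝓘(ℝ, E) x) : ℝ :=
  ∑ k, inner ℝ (hessian f x (e k)) (e k)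

/-- The trace of the quadratic form `df ⊗ df` on the frame `e`. -/
noncomputable def dSqTrace (f : X → ℝ) (x : X) (e : Fin p → TangentSpace 𝓘(ℝ, E) x) : ℝ :=
  ∑ k, mvfderiv 𝓘(ℝ, E) f x (e k) ^ 2

theorem dSqTrace_nonneg (f : X → ℝ) (x : X) (e : Fin p → TangentSpace 𝓘(ℝ, E) x) :
    0 ≤ dSqTrace f x e :=
  Finset.sum_nonneg fun _ _ => sq_nonneg _

theorem dSqTrace_eq_zero_iff {e : Fin p → TangentSpace 𝓘(ℝ, E) x} :
    dSqTrace f x e = 0 ↔ ∀ k, mvfderiv 𝓘(ℝ, E) f x (e k) = 0 := by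
  simp [dSqTrace, Finset.sum_eq_zero_iff_of_nonneg, sq_nonneg]

theorem hessianTrace_congr (hU : IsOpen U) (hx : x ∈ U)
    (hf : ContMDiffOn 𝓘(ℝ, E) 𝓘(ℝ, ℝ) ∞ f U) (hg : ContMDiffOn 𝓘(ℝ, E) 𝓘(ℝ, ℝ) ∞ g U)
    (h : f =ᶠ[𝓝 x] g) (e : Fin p → TangentSpace 𝓘(ℝ, E) x) :
    hessianTrace f x e = hessianTrace g x e := by
  simp only [hessianTrace, hessian_congr hU hx hf hg h]

theorem hessianTrace_add (hU : IsOpen U) (hx : x ∈ U)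
    (hf : ContMDiffOn 𝓘(ℝ, E) 𝓘(ℝ, ℝ) ∞ f U) (hg : ContMDiffOn 𝓘(ℝ, E) 𝓘(ℝ, ℝ) ∞ g U)
    (e : Fin p → TangentSpace 𝓘(ℝ, E) x) :
    hessianTrace (f + g) x e = hessianTrace f x e + hessianTrace g x e := by
  simp only [hessianTrace, hessian_add hU hx hf hg, ← Finset.sum_add_distrib, ← inner_add_left]
  rfl

theorem hessianTrace_const_mul (c : ℝ) (hU : IsOpen U) (hx : x ∈ U)
    (hf : ContMDiffOn 𝓘(ℝ, E) 𝓘(ℝ, ℝ) ∞ f U) (e : Fin p → TangentSpace 𝓘(ℝ, E) x) :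
    hessianTrace (fun y => c * f y) x e = c * hessianTrace f x e := by
  simp only [hessianTrace, hessian_const_mul c hU hx hf, Finset.mul_sum]

theorem hessianTrace_comp {η : ℝ → ℝ} {ρ : X → ℝ} (hη : ContDiff ℝ ∞ η) (hU : IsOpen U)
    (hx : x ∈ U) (hρ : ContMDiffOn 𝓘(ℝ, E) 𝓘(ℝ, ℝ) ∞ ρ U)
    (e : Fin p → TangentSpace 𝓘(ℝ, E) x) :
    hessianTrace (fun y => η (ρ y)) x e =
      deriv η (ρ x) * hessianTrace ρ x e + deriv (deriv η) (ρ x) * dSqTrace ρ x e := by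
  simp only [hessianTrace, dSqTrace, inner_hessian_comp hη hU hx hρ, Finset.sum_add_distrib,
    Finset.mul_sum]

end Hessian

/-! ### The first cousin principle -/

section FirstCousin

theorem orthonormal_update {p : ℕ} {T : Type*} [NormedAddCommGroup T] [InnerProductSpace ℝ T]
    {e : Fin p → T} (he : Orthonormal ℝ e) {k : Fin p} {u : T} (hu : ‖u‖ = 1)
    (hue : ∀ j, j ≠ k → inner ℝ u (e j) = 0) : Orthonormal ℝ (Function.update e k u) := by
  refine ⟨fun i => ?_, fun i j hij => ?_⟩
  · rcases eq_or_ne i k with rfl | h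
    · simpa using hu
    · simpa [h] using he.1 i
  · rcases eq_or_ne i k with rfl | h
    · simpa [hij.symm] using hue j hij.symm
    · rcases eq_or_ne j k with rfl | h'
      · simpa [h, real_inner_comm] using hue i h
      · simpa [h, h'] using he.2 hij

/-- The first cousin principle: a form of comass at most `1` that takes the value `1` on the
orthonormal frame `e` restricts, in each slot, to the inner product with the vector in that slot. -/
theorem apply_update_of_maximal {p : ℕ} {T : Type*} [NormedAddCommGroup T]
    [InnerProductSpace ℝ T] (α : T [⋀^Fin p]→L[ℝ] ℝ)
    (hα : ∀ e : Fin p → T, Orthonormal ℝ e → α e ≤ 1) {e : Fin p → T} (he : Orthonormal ℝ e)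
    (h1 : α e = 1) (k : Fin p) (w : T) : α (Function.update e k w) = inner ℝ w (e k) := by
  let L : T →ₗ[ℝ] ℝ := α.toMultilinearMap.toLinearMap e k
  have hL : ∀ w, L w = α (Function.update e k w) := fun w => rfl
  have hLk : L (e k) = 1 := by rw [hL, Function.update_eq_self, h1]
  have hLj : ∀ j, j ≠ k → L (e j) = 0 := fun j hj => by
    rw [hL]
    exact α.toAlternatingMap.map_update_self e hj.symm
  -- turning `e k` towards a vector `w` normal to the plane keeps the frame orthonormal, so that
  -- maximality kills the first-order term `L w`
  have hperp : ∀ w : T, (∀ j, inner ℝ w (e j) = 0) → L w = 0 := by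
    intro w hw
    by_contra hne
    have hineq : ∀ s : ℝ, 1 + s * L w ≤ Real.sqrt (1 + s ^ 2 * ‖w‖ ^ 2) := by
      intro s
      have hn : ‖e k + s • w‖ = Real.sqrt (1 + s ^ 2 * ‖w‖ ^ 2) := by
        rw [eq_comm, Real.sqrt_eq_iff_eq_sq (by positivity) (norm_nonneg _),
          norm_add_sq_real, he.1 k, inner_smul_right, real_inner_comm, hw k, norm_smul, mul_pow]
        simp
      set N := Real.sqrt (1 + s ^ 2 * ‖w‖ ^ 2) with hN
      have hNpos : 0 < N := Real.sqrt_pos.2 (by positivity)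
      have ho := orthonormal_update he (k := k) (u := N⁻¹ • (e k + s • w))
        (by rw [norm_smul, hn, norm_inv, Real.norm_of_nonneg hNpos.le,
              inv_mul_cancel₀ hNpos.ne'])
        (fun j hj => by
          rw [inner_smul_left, inner_add_left, inner_smul_left, hw j, he.2 hj.symm]; simp)
      have h2 := hα _ ho
      rw [← hL, map_smul, map_add, map_smul, hLk, smul_eq_mul, smul_eq_mul,
        inv_mul_le_iff₀ hNpos, mul_one] at h2
      exact h2
    -- at `s = t L w`, squaring the inequality gives `2 t (L w) ^ 2 ≤ t ^ 2 ‖w‖ ^ 2 (L w) ^ 2`,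
    -- which fails as soon as `t ‖w‖ ^ 2 < 2`
    set t := (‖w‖ ^ 2 + 1)⁻¹ with ht
    have htpos : 0 < t := by positivity
    have h3 := hineq (t * L w)
    have h4 : 0 ≤ 1 + t * L w * L w := by
      have : 0 ≤ t * (L w * L w) := mul_nonneg htpos.le (mul_self_nonneg _)
      linarith [mul_assoc t (L w) (L w)]
    rw [Real.le_sqrt h4 (by positivity)] at h3
    have hLpos : 0 < L w ^ 2 := by positivity
    have h5 : t * (‖w‖ ^ 2 + 1) = 1 := inv_mul_cancel₀ (by positivity)
    have h6 : t * ‖w‖ ^ 2 ≤ 1 := by nlinarith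
    have h7 : 2 * (t * L w ^ 2) ≤ (t * ‖w‖ ^ 2) * (t * L w ^ 2) := by
      nlinarith [sq_nonneg (t * L w ^ 2)]
    have h8 : 0 < t * L w ^ 2 := by positivity
    nlinarith
  have hsplit : L (w - ∑ j, (inner ℝ w (e j) : ℝ) • e j) = 0 := by
    refine hperp _ fun i => ?_
    rw [inner_sub_left, sum_inner, Finset.sum_eq_single i]
    · simp [inner_smul_left, he.1 i]
    · intro j _ hj
      rw [inner_smul_left, he.2 hj, mul_zero]
    · simp
  rw [map_sub, map_sum, Finset.sum_eq_single k] at hsplit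
  · rw [map_smul, hLk, smul_eq_mul, mul_one, sub_eq_zero] at hsplit
    rw [← hL, hsplit]
  · intro j _ hj
    rw [map_smul, hLj j hj, smul_zero]
  · simp

end FirstCousin

/-! ### The `φ`-Hessian on `φ`-planes -/

section PhiHessian

variable {E : Type*} [NormedAddCommGroup E] [NormedSpace ℝ E] [FiniteDimensional ℝ E]
  {X : Type*} [TopologicalSpace X] [ChartedSpace E X] [IsManifold 𝓘(ℝ, E) ∞ X]
  [RiemannianBundle (fun x : X => TangentSpace 𝓘(ℝ, E) x)]
  [IsContMDiffRiemannianBundle 𝓘(ℝ, E) ∞ E (fun x : X => TangentSpace 𝓘(ℝ, E) x)]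
  {p : ℕ} {φ : Π x : X, TangentSpace 𝓘(ℝ, E) x [⋀^Fin p]→L[ℝ] ℝ}

/-- On a `φ`-plane the `φ`-Hessian is the trace of the Riemannian Hessian, by the first cousin
principle; beyond the `φ`-planes themselves, `φ` no longer matters. -/
theorem IsPhiPlane.phiHessian_eq (hφ : IsCalibration φ) {x : X}
    {e : Fin p → TangentSpace 𝓘(ℝ, E) x} (he : IsPhiPlane φ x e) (f : X → ℝ) :
    phiHessian φ f x e = hessianTrace f x e :=
  Finset.sum_congr rfl fun k _ =>
    apply_update_of_maximal (φ x) (hφ.comass_le_one x) he.1 he.2 k _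

end PhiHessian

/-! ### Continuity in coordinates -/

section Continuity

variable {E : Type*} [NormedAddCommGroup E] [NormedSpace ℝ E] [FiniteDimensional ℝ E]
  {X : Type*} [TopologicalSpace X] [ChartedSpace E X] [IsManifold 𝓘(ℝ, E) ∞ X]
  {p : ℕ} {φ : Π x : X, TangentSpace 𝓘(ℝ, E) x [⋀^Fin p]→L[ℝ] ℝ} {f : X → ℝ} {U : Set X}

/-- The coordinate expression of a form is its value on coordinate fields. -/
theorem formInChart_apply (φ : Π x : X, TangentSpace 𝓘(ℝ, E) x [⋀^Fin p]→L[ℝ] ℝ) {x₀ : X}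
    {y : E} (hy : y ∈ (chartAt E x₀).target) (u : Fin p → E) :
    formInChart φ x₀ y u =
      φ ((chartAt E x₀).symm y) (fun k => coordField E x₀ (u k) ((chartAt E x₀).symm y)) := by
  have hx : (chartAt E x₀).symm y ∈ (chartAt E x₀).source := (chartAt E x₀).map_target hy
  have h1 : ∀ v : E, mfderiv 𝓘(ℝ, E) 𝓘(ℝ, E) (chartAt E x₀).symm y v =
      coordField E x₀ v ((chartAt E x₀).symm y) := by
    intro v
    unfold coordField
    rw [TangentBundle.symmL_trivializationAt hx]
    have h2 : ∀ z : E, z = y → (mfderiv 𝓘(ℝ, E) 𝓘(ℝ, E) (chartAt E x₀).symm y : E → E) v =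
        (mfderivWithin 𝓘(ℝ, E) 𝓘(ℝ, E) (extChartAt 𝓘(ℝ, E) x₀).symm (range 𝓘(ℝ, E)) z :
          E → E) v := by
      rintro z rfl
      simp only [mfderivWithin_univ, mfld_simps]
      rfl
    exact h2 _ (by simp [(chartAt E x₀).right_inv hy])
  change φ ((chartAt E x₀).symm y) (fun k => mfderiv 𝓘(ℝ, E) 𝓘(ℝ, E) (chartAt E x₀).symm y (u k))
    = _
  congr 1
  funext k
  exact h1 (u k)

theorem continuousAt_form_coordField (hφ : IsSmoothForm φ) (x₀ : X) (u₀ : Fin p → E) :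
    ContinuousAt (fun q : X × (Fin p → E) => φ q.1 (fun k => coordField E x₀ (q.2 k) q.1))
      (x₀, u₀) := by
  have hx₀ := mem_chart_source E x₀
  have h1 : ContinuousAt (fun q : X × (Fin p → E) => formInChart φ x₀ (chartAt E x₀ q.1))
      (x₀, u₀) := by
    have hc : ContinuousAt (formInChart φ x₀) (chartAt E x₀ x₀) :=
      (hφ x₀).continuousOn.continuousAt
        ((chartAt E x₀).open_target.mem_nhds (mem_chart_target E x₀))
    have hc2 : ContinuousAt (fun q : X × (Fin p → E) => chartAt E x₀ q.1) (x₀, u₀) :=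
      ((chartAt E x₀).continuousAt hx₀).comp continuousAt_fst
    exact ContinuousAt.comp (f := fun q : X × (Fin p → E) => chartAt E x₀ q.1)
      (g := formInChart φ x₀) hc hc2
  have h2 : ContinuousAt (fun q : X × (Fin p → E) => formInChart φ x₀ (chartAt E x₀ q.1) q.2)
      (x₀, u₀) := by
    have := ContinuousAt.prodMk h1 continuousAt_snd
    exact (continuous_eval (F := E [⋀^Fin p]→L[ℝ] ℝ)).continuousAt.comp this
  refine h2.congr ?_
  have : ∀ᶠ q : X × (Fin p → E) in 𝓝 (x₀, u₀), q.1 ∈ (chartAt E x₀).source :=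
    continuousAt_fst.eventually ((chartAt E x₀).open_source.mem_nhds hx₀)
  filter_upwards [this] with q hq
  rw [formInChart_apply φ ((chartAt E x₀).map_source hq), (chartAt E x₀).left_inv hq]

theorem continuousAt_mvfderiv_coordField (hU : IsOpen U)
    (hf : ContMDiffOn 𝓘(ℝ, E) 𝓘(ℝ, ℝ) ∞ f U) {x₀ : X} (hx₀ : x₀ ∈ U) (u₀ : E) :
    ContinuousAt (fun q : X × E => mvfderiv 𝓘(ℝ, E) f q.1 (coordField E x₀ q.2 q.1))
      (x₀, u₀) := by
  let b := Module.finBasis ℝ E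
  have hS : IsOpen ((chartAt E x₀).source ∩ U) := (chartAt E x₀).open_source.inter hU
  have h1 : ContinuousAt (fun q : X × E => ∑ i, b.repr q.2 i *
      mvfderiv 𝓘(ℝ, E) f q.1 (coordField E x₀ (b i) q.1)) (x₀, u₀) := by
    refine tendsto_finsetSum _ fun i _ => ContinuousAt.mul ?_ ?_
    · have : Continuous fun u : E => b.repr u i :=
        (b.coord i).continuous_of_finiteDimensional
      exact this.continuousAt.comp continuousAt_snd
    · have h := contMDiffOn_mvfderiv_apply hS (hf.mono inter_subset_right)
        ((contMDiffOn_coordField x₀ (b i)).mono inter_subset_left)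
      have h2 := h.continuousOn.continuousAt (hS.mem_nhds ⟨mem_chart_source E x₀, hx₀⟩)
      exact ContinuousAt.comp (f := fun q : X × E => q.1)
        (g := fun y => mvfderiv 𝓘(ℝ, E) f y (coordField E x₀ (b i) y)) h2 continuousAt_fst
  refine h1.congr (Eventually.of_forall fun q => ?_)
  beta_reduce
  conv_rhs => rw [← b.sum_repr q.2, coordField_sum, map_sum]
  simp

variable [RiemannianBundle (fun x : X => TangentSpace 𝓘(ℝ, E) x)]
  [IsContMDiffRiemannianBundle 𝓘(ℝ, E) ∞ E (fun x : X => TangentSpace 𝓘(ℝ, E) x)]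

theorem contMDiffAt_inner {n : WithTop ℕ∞} (hn : n ≤ ∞) {V W : Π x : X, TangentSpace 𝓘(ℝ, E) x}
    {x : X} (hV : ContMDiffAt 𝓘(ℝ, E) (𝓘(ℝ, E).prod 𝓘(ℝ, E)) n (T% V) x)
    (hW : ContMDiffAt 𝓘(ℝ, E) (𝓘(ℝ, E).prod 𝓘(ℝ, E)) n (T% W) x) :
    ContMDiffAt 𝓘(ℝ, E) 𝓘(ℝ, ℝ) n (fun y => (inner ℝ (V y) (W y) : ℝ)) x :=
  haveI : IsContMDiffRiemannianBundle 𝓘(ℝ, E) n E (fun x : X => TangentSpace 𝓘(ℝ, E) x) :=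
    IsContMDiffRiemannianBundle.of_le hn
  ContMDiffAt.inner_bundle (E := fun x : X => TangentSpace 𝓘(ℝ, E) x) hV hW

theorem continuousOn_koszul {V W Z : Π x : X, TangentSpace 𝓘(ℝ, E) x} (hU : IsOpen U)
    (hW : ContMDiffOn 𝓘(ℝ, E) (𝓘(ℝ, E).prod 𝓘(ℝ, E)) ∞ (T% W) U)
    (hV : ContMDiffOn 𝓘(ℝ, E) (𝓘(ℝ, E).prod 𝓘(ℝ, E)) ∞ (T% V) U)
    (hZ : ContMDiffOn 𝓘(ℝ, E) (𝓘(ℝ, E).prod 𝓘(ℝ, E)) ∞ (T% Z) U) :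
    ContinuousOn (koszul W V Z) U := by
  have hd : ∀ {V W Z : Π x : X, TangentSpace 𝓘(ℝ, E) x},
      ContMDiffOn 𝓘(ℝ, E) (𝓘(ℝ, E).prod 𝓘(ℝ, E)) ∞ (T% W) U →
      ContMDiffOn 𝓘(ℝ, E) (𝓘(ℝ, E).prod 𝓘(ℝ, E)) ∞ (T% V) U →
      ContMDiffOn 𝓘(ℝ, E) (𝓘(ℝ, E).prod 𝓘(ℝ, E)) ∞ (T% Z) U →
      ContinuousOn (fun x => mvfderiv 𝓘(ℝ, E) (fun y => (inner ℝ (W y) (Z y) : ℝ)) x (V x)) U :=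
    fun hW hV hZ => (contMDiffOn_mvfderiv_apply hU (contMDiffOn_inner hW hZ) hV).continuousOn
  have hb : ∀ {V W Z : Π x : X, TangentSpace 𝓘(ℝ, E) x},
      ContMDiffOn 𝓘(ℝ, E) (𝓘(ℝ, E).prod 𝓘(ℝ, E)) ∞ (T% W) U →
      ContMDiffOn 𝓘(ℝ, E) (𝓘(ℝ, E).prod 𝓘(ℝ, E)) ∞ (T% V) U →
      ContMDiffOn 𝓘(ℝ, E) (𝓘(ℝ, E).prod 𝓘(ℝ, E)) ∞ (T% Z) U →
      ContinuousOn (fun x => (inner ℝ (VectorField.mlieBracket 𝓘(ℝ, E) V W x) (Z x) : ℝ)) U := by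
    intro V W Z hW hV hZ x hx
    haveI : CompleteSpace E := FiniteDimensional.complete ℝ E
    have hxU := hU.mem_nhds hx
    haveI : IsManifold 𝓘(ℝ, E) (((1 : ℕ∞) : WithTop ℕ∞) + 1) X :=
      IsManifold.of_le (n := ∞) (by norm_cast)
    haveI : IsManifold 𝓘(ℝ, E) (minSmoothness ℝ 2) X := by
      rw [minSmoothness_of_isRCLikeNormedField]; infer_instance
    have h1 : ContMDiffAt 𝓘(ℝ, E) (𝓘(ℝ, E).prod 𝓘(ℝ, E)) ((0 : ℕ∞) : WithTop ℕ∞)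
        (T% (VectorField.mlieBracket 𝓘(ℝ, E) V W)) x :=
      ContMDiffAt.mlieBracket_vectorField (n := 1)
        ((hV.contMDiffAt hxU).of_le (by norm_cast))
        ((hW.contMDiffAt hxU).of_le (by norm_cast)) (by simp [minSmoothness_of_isRCLikeNormedField])
    have h2 : ContMDiffAt 𝓘(ℝ, E) (𝓘(ℝ, E).prod 𝓘(ℝ, E)) 0 (T% Z) x :=
      (hZ.contMDiffAt hxU).of_le (by simp)
    exact (contMDiffAt_inner (by simp) h1 h2).continuousAt.continuousWithinAt
  exact continuousOn_const.mul
    ((((((hd hW hV hZ).add (hd hV hW hZ)).sub (hd hV hZ hW)).add (hb hW hV hZ)).sub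
      (hb hZ hV hW)).sub (hb hZ hW hV))

theorem continuousAt_inner_coordField (x₀ : X) (q₀ : E × E) :
    ContinuousAt (fun q : X × (E × E) =>
      (inner ℝ (coordField E x₀ q.2.1 q.1) (coordField E x₀ q.2.2 q.1) : ℝ)) (x₀, q₀) := by
  let b := Module.finBasis ℝ E
  have hr : ∀ i, Continuous fun u : E => b.repr u i :=
    fun i => (b.coord i).continuous_of_finiteDimensional
  have h1 : ContinuousAt (fun q : X × (E × E) => ∑ i, ∑ j, b.repr q.2.1 i * (b.repr q.2.2 j *
      (inner ℝ (coordField E x₀ (b i) q.1) (coordField E x₀ (b j) q.1) : ℝ))) (x₀, q₀) := by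
    refine tendsto_finsetSum _ fun i _ => tendsto_finsetSum _ fun j _ =>
      ContinuousAt.mul ?_ (ContinuousAt.mul ?_ ?_)
    · exact (hr i).continuousAt.comp (continuousAt_fst.comp continuousAt_snd)
    · exact (hr j).continuousAt.comp (continuousAt_snd.comp continuousAt_snd)
    · have h := (contMDiffOn_inner (contMDiffOn_coordField x₀ (b i))
        (contMDiffOn_coordField x₀ (b j))).continuousOn.continuousAt
          ((chartAt E x₀).open_source.mem_nhds (mem_chart_source E x₀))
      exact ContinuousAt.comp (f := fun q : X × (E × E) => q.1)
        (g := fun y => (inner ℝ (coordField E x₀ (b i) y) (coordField E x₀ (b j) y) : ℝ))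
        h continuousAt_fst
  refine h1.congr (Eventually.of_forall fun q => ?_)
  beta_reduce
  conv_rhs => rw [← b.sum_repr q.2.1, ← b.sum_repr q.2.2, coordField_sum, coordField_sum]
  rw [sum_inner]
  refine Finset.sum_congr rfl fun i _ => ?_
  rw [inner_sum]
  refine Finset.sum_congr rfl fun j _ => ?_
  rw [inner_smul_left, inner_smul_right]
  rfl

theorem continuousAt_hessian_coordField (hU : IsOpen U)
    (hf : ContMDiffOn 𝓘(ℝ, E) 𝓘(ℝ, ℝ) ∞ f U) {x₀ : X} (hx₀ : x₀ ∈ U) (u₀ : E) :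
    ContinuousAt (fun q : X × E =>
      (inner ℝ (hessian f q.1 (coordField E x₀ q.2 q.1)) (coordField E x₀ q.2 q.1) : ℝ))
      (x₀, u₀) := by
  let b := Module.finBasis ℝ E
  have hr : ∀ i, Continuous fun u : E => b.repr u i :=
    fun i => (b.coord i).continuous_of_finiteDimensional
  set S := (chartAt E x₀).source ∩ U with hSdef
  have hS : IsOpen S := (chartAt E x₀).open_source.inter hU
  have hx₀S : S ∈ 𝓝 x₀ := hS.mem_nhds ⟨mem_chart_source E x₀, hx₀⟩
  have hF : ∀ i, ContMDiffOn 𝓘(ℝ, E) (𝓘(ℝ, E).prod 𝓘(ℝ, E)) ∞ (T% (coordField E x₀ (b i))) S :=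
    fun i => (contMDiffOn_coordField x₀ (b i)).mono inter_subset_left
  have hg := (contMDiffOn_grad hU hf).mono (inter_subset_right : S ⊆ U)
  have h1 : ContinuousAt (fun q : X × E => ∑ i, ∑ j, b.repr q.2 i * (b.repr q.2 j *
      koszul (grad f) (coordField E x₀ (b i)) (coordField E x₀ (b j)) q.1)) (x₀, u₀) := by
    refine tendsto_finsetSum _ fun i _ => tendsto_finsetSum _ fun j _ =>
      ContinuousAt.mul ?_ (ContinuousAt.mul ?_ ?_)
    · exact (hr i).continuousAt.comp continuousAt_snd
    · exact (hr j).continuousAt.comp continuousAt_snd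
    · have h := (continuousOn_koszul hS hg (hF i) (hF j)).continuousAt hx₀S
      exact ContinuousAt.comp (f := fun q : X × E => q.1)
        (g := koszul (grad f) (coordField E x₀ (b i)) (coordField E x₀ (b j)))
        h continuousAt_fst
  refine h1.congr ?_
  have : ∀ᶠ q : X × E in 𝓝 (x₀, u₀), q.1 ∈ S := continuousAt_fst.eventually hx₀S
  filter_upwards [this] with q hq
  have hm : ∀ i, MDiffAt (T% (coordField E x₀ (b i))) q.1 := fun i =>
    ((hF i).contMDiffAt (hS.mem_nhds hq)).mdifferentiableAt (by simp)
  have hmg := mdifferentiableAt_grad hU hq.2 hf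
  conv_rhs => rw [← b.sum_repr q.2, coordField_sum, map_sum]
  rw [sum_inner]
  refine Finset.sum_congr rfl fun i _ => ?_
  rw [inner_sum]
  refine Finset.sum_congr rfl fun j _ => ?_
  rw [map_smul, inner_smul_left, inner_smul_right, hessian,
    inner_leviCivita hmg (hm i) (hm j)]
  rfl

end Continuity

/-! ### Compactness of the set of `φ`-planes -/

section Compactness

variable {E : Type*} [NormedAddCommGroup E] [NormedSpace ℝ E] [FiniteDimensional ℝ E]
  {X : Type*} [TopologicalSpace X] [ChartedSpace E X] [IsManifold 𝓘(ℝ, E) ∞ X]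
  [RiemannianBundle (fun x : X => TangentSpace 𝓘(ℝ, E) x)]
  [IsContMDiffRiemannianBundle 𝓘(ℝ, E) ∞ E (fun x : X => TangentSpace 𝓘(ℝ, E) x)]
  {p : ℕ} {φ : Π x : X, TangentSpace 𝓘(ℝ, E) x [⋀^Fin p]→L[ℝ] ℝ} {f : X → ℝ} {U : Set X}

/-- The frame at `x` with components `u` in the chart at `x₀`. -/
noncomputable def coordFrame (x₀ : X) (q : X × (Fin p → E)) :
    Fin p → TangentSpace 𝓘(ℝ, E) q.1 :=
  fun k => coordField E x₀ (q.2 k) q.1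

/-- A function `A` of tangent frames is continuous over `x₀` if it depends continuously on the base
point and on the components of the frame in the chart at `x₀`, at all frames based at `x₀`. -/
def FrameContinuousAt (A : Π x : X, (Fin p → TangentSpace 𝓘(ℝ, E) x) → ℝ) (x₀ : X) : Prop :=
  ∀ u₀ : Fin p → E, ContinuousAt (fun q : X × (Fin p → E) => A q.1 (coordFrame x₀ q)) (x₀, u₀)

theorem continuousAt_component {x₀ : X} {u₀ : Fin p → E} (k : Fin p) :
    ContinuousAt (fun q : X × (Fin p → E) => (q.1, q.2 k)) (x₀, u₀) :=
  continuousAt_fst.prodMk ((continuous_apply k).continuousAt.comp continuousAt_snd)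

theorem frameContinuousAt_hessianTrace (hU : IsOpen U)
    (hf : ContMDiffOn 𝓘(ℝ, E) 𝓘(ℝ, ℝ) ∞ f U) {x₀ : X} (hx₀ : x₀ ∈ U) :
    FrameContinuousAt (E := E) (p := p) (hessianTrace f) x₀ := fun u₀ =>
  tendsto_finsetSum _ fun k _ =>
    ContinuousAt.comp (x := (x₀, u₀)) (f := fun q : X × (Fin p → E) => (q.1, q.2 k))
      (g := fun q : X × E => (inner ℝ (hessian f q.1 (coordField E x₀ q.2 q.1))
        (coordField E x₀ q.2 q.1) : ℝ))
      (continuousAt_hessian_coordField hU hf hx₀ (u₀ k)) (continuousAt_component k)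

theorem frameContinuousAt_dSqTrace (hU : IsOpen U)
    (hf : ContMDiffOn 𝓘(ℝ, E) 𝓘(ℝ, ℝ) ∞ f U) {x₀ : X} (hx₀ : x₀ ∈ U) :
    FrameContinuousAt (E := E) (p := p) (dSqTrace f) x₀ := fun u₀ =>
  tendsto_finsetSum _ fun k _ => ContinuousAt.pow
    (ContinuousAt.comp (x := (x₀, u₀)) (f := fun q : X × (Fin p → E) => (q.1, q.2 k))
      (g := fun q : X × E => mvfderiv 𝓘(ℝ, E) f q.1 (coordField E x₀ q.2 q.1))
      (continuousAt_mvfderiv_coordField hU hf hx₀ (u₀ k)) (continuousAt_component k)) 2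

theorem eventually_not_isPhiPlane (hφ : IsSmoothForm φ) {x₀ : X} {u₀ : Fin p → E}
    (h : ¬ IsPhiPlane φ x₀ (coordFrame x₀ (x₀, u₀))) :
    ∀ᶠ q : X × (Fin p → E) in 𝓝 (x₀, u₀), ¬ IsPhiPlane φ q.1 (coordFrame x₀ q) := by
  simp only [IsPhiPlane, orthonormal_iff_ite, not_and_or, not_forall] at h ⊢
  rcases h with ⟨i, j, h⟩ | h
  · have hc : ContinuousAt (fun q : X × (Fin p → E) =>
        (inner ℝ (coordFrame x₀ q i) (coordFrame x₀ q j) : ℝ)) (x₀, u₀) :=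
      ContinuousAt.comp (x := (x₀, u₀))
        (f := fun q : X × (Fin p → E) => (q.1, (q.2 i, q.2 j)))
        (g := fun q : X × (E × E) =>
          (inner ℝ (coordField E x₀ q.2.1 q.1) (coordField E x₀ q.2.2 q.1) : ℝ))
        (continuousAt_inner_coordField x₀ (u₀ i, u₀ j))
        (continuousAt_fst.prodMk
          (((continuous_apply i).continuousAt.comp continuousAt_snd).prodMk
            ((continuous_apply j).continuousAt.comp continuousAt_snd)))
    filter_upwards [hc.eventually_ne h] with q hq
    exact Or.inl ⟨i, j, hq⟩
  · filter_upwards [(continuousAt_form_coordField hφ x₀ u₀).eventually_ne h] with q hq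
    exact Or.inr hq

/-- Near a given point, all orthonormal frames have components bounded by a common constant. -/
theorem exists_eventually_coordFrame (x₀ : X) :
    ∃ R : ℝ, ∀ᶠ x in 𝓝 x₀, ∀ e : Fin p → TangentSpace 𝓘(ℝ, E) x, Orthonormal ℝ e →
      ∃ u ∈ Metric.closedBall (0 : Fin p → E) R, coordFrame x₀ (x, u) = e := by
  haveI : IsContinuousRiemannianBundle E (fun x : X => TangentSpace 𝓘(ℝ, E) x) := by
    obtain ⟨g, hg, hgi⟩ := IsContMDiffRiemannianBundle.exists_contMDiff
      (IB := 𝓘(ℝ, E)) (n := ∞) (F := E) (E := fun x : X => TangentSpace 𝓘(ℝ, E) x)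
    exact ⟨g, hg.continuous, hgi⟩
  obtain ⟨R, hR, h⟩ := eventually_norm_trivializationAt_lt E
    (fun x : X => TangentSpace 𝓘(ℝ, E) x) x₀
  refine ⟨R, ?_⟩
  filter_upwards [h, (chartAt E x₀).open_source.mem_nhds (mem_chart_source E x₀)]
    with x hx hxs e he
  refine ⟨fun k => (trivializationAt E (TangentSpace 𝓘(ℝ, E)) x₀).continuousLinearMapAt ℝ x (e k),
    ?_, funext fun k => coordField_continuousLinearMapAt hxs (e k)⟩
  rw [mem_closedBall_zero_iff, pi_norm_le_iff_of_nonneg hR.le]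
  intro k
  refine (ContinuousLinearMap.le_opNorm _ (e k)).trans ?_
  rw [he.1 k, mul_one]
  exact hx.le

/-- The local form of `exists_forall_isPhiPlane_of_isCompact`: the components of the
`φ`-planes near `x₀` lie in a compact ball, and each point of this ball has a neighborhood on which
one constant suffices. -/
theorem exists_eventually_forall_isPhiPlane (hφ : IsSmoothForm φ) {x₀ : X}
    {A B : Π x : X, (Fin p → TangentSpace 𝓘(ℝ, E) x) → ℝ}
    (hA : FrameContinuousAt A x₀) (hB : FrameContinuousAt B x₀)
    (h : ∀ e, IsPhiPlane φ x₀ e → 0 < A x₀ e ∨ 0 < B x₀ e) :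
    ∃ C : ℝ, ∀ᶠ x in 𝓝 x₀, ∀ e, IsPhiPlane φ x e → 0 ≤ A x e →
      ∀ C' ≥ C, 0 < B x e + C' * A x e := by
  obtain ⟨R, hR⟩ := exists_eventually_coordFrame (E := E) (p := p) x₀
  suffices H : ∃ C : ℝ, ∀ᶠ x in 𝓝 x₀, ∀ u ∈ Metric.closedBall (0 : Fin p → E) R,
      IsPhiPlane φ x (coordFrame x₀ (x, u)) → 0 ≤ A x (coordFrame x₀ (x, u)) →
      ∀ C' ≥ C, 0 < B x (coordFrame x₀ (x, u)) + C' * A x (coordFrame x₀ (x, u)) by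
    obtain ⟨C, hC⟩ := H
    refine ⟨C, ?_⟩
    filter_upwards [hC, hR] with x hx hxR e he
    obtain ⟨u, hu, rfl⟩ := hxR e he.1
    exact hx u hu he
  refine (isCompact_closedBall (0 : Fin p → E) R).induction_on
    (p := fun s => ∃ C : ℝ, ∀ᶠ x in 𝓝 x₀, ∀ u ∈ s,
      IsPhiPlane φ x (coordFrame x₀ (x, u)) → 0 ≤ A x (coordFrame x₀ (x, u)) →
      ∀ C' ≥ C, 0 < B x (coordFrame x₀ (x, u)) + C' * A x (coordFrame x₀ (x, u)))
    ⟨0, by simp⟩ ?_ ?_ ?_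
  · rintro s t hst ⟨C, hC⟩
    exact ⟨C, hC.mono fun x hx u hu => hx u (hst hu)⟩
  · rintro s t ⟨C, hC⟩ ⟨D, hD⟩
    refine ⟨max C D, ?_⟩
    filter_upwards [hC, hD] with x hx hx' u hu hu1 hu2 C' hC'
    rcases hu with hu | hu
    · exact hx u hu hu1 hu2 C' ((le_max_left _ _).trans hC')
    · exact hx' u hu hu1 hu2 C' ((le_max_right _ _).trans hC')
  · intro u₀ _
    suffices H : ∃ C : ℝ, ∀ᶠ q : X × (Fin p → E) in 𝓝 (x₀, u₀),
        IsPhiPlane φ q.1 (coordFrame x₀ q) → 0 ≤ A q.1 (coordFrame x₀ q) →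
        ∀ C' ≥ C, 0 < B q.1 (coordFrame x₀ q) + C' * A q.1 (coordFrame x₀ q) by
      obtain ⟨C, hC⟩ := H
      rw [nhds_prod_eq, eventually_prod_iff] at hC
      obtain ⟨P, hP, Q, hQ, hPQ⟩ := hC
      exact ⟨{u | Q u}, mem_nhdsWithin_of_mem_nhds hQ, C,
        hP.mono fun x hx u hu => hPQ hx hu⟩
    by_cases hp : IsPhiPlane φ x₀ (coordFrame x₀ (x₀, u₀))
    · rcases h _ hp with hpos | hpos
      · set a := A x₀ (coordFrame x₀ (x₀, u₀)) with ha
        set b := B x₀ (coordFrame x₀ (x₀, u₀)) with hb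
        refine ⟨2 * (|b| + 1) / a, ?_⟩
        filter_upwards [(hA u₀).eventually (lt_mem_nhds (half_lt_self hpos)),
          (hB u₀).eventually (lt_mem_nhds (sub_one_lt b))] with q hqA hqB _ _ C' hC'
        have h1 : |b| + 1 ≤ C' * (a / 2) := by
          rw [ge_iff_le, div_le_iff₀ hpos] at hC'
          linarith
        have hC'0 : 0 ≤ C' := le_trans (by positivity) hC'
        have h2 : C' * (a / 2) ≤ C' * A q.1 (coordFrame x₀ q) :=
          mul_le_mul_of_nonneg_left hqA.le hC'0
        linarith [neg_abs_le b]
      · refine ⟨0, ?_⟩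
        filter_upwards [(hB u₀).eventually (lt_mem_nhds hpos)] with q hqB _ hqA C' hC'
        exact add_pos_of_pos_of_nonneg hqB (mul_nonneg hC' hqA)
    · exact ⟨0, (eventually_not_isPhiPlane hφ hp).mono fun q hq h => absurd h hq⟩

/-- Compactness of the set of `φ`-planes over a compact set `K`, in the form used below: if at every
`φ`-plane over `K` one of the continuous functions `A ≥ 0` and `B` is positive, then `B + C A` is
positive at all `φ`-planes over `K` for all large `C`. -/
theorem exists_forall_isPhiPlane_of_isCompact (hφ : IsSmoothForm φ) {K : Set X} (hK : IsCompact K)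
    {A B : Π x : X, (Fin p → TangentSpace 𝓘(ℝ, E) x) → ℝ}
    (hA : ∀ x ∈ K, FrameContinuousAt A x) (hB : ∀ x ∈ K, FrameContinuousAt B x)
    (hA0 : ∀ x ∈ K, ∀ e, IsPhiPlane φ x e → 0 ≤ A x e)
    (h : ∀ x ∈ K, ∀ e, IsPhiPlane φ x e → 0 < A x e ∨ 0 < B x e) :
    ∃ C : ℝ, ∀ x ∈ K, ∀ e, IsPhiPlane φ x e → ∀ C' ≥ C, 0 < B x e + C' * A x e := by
  suffices H : ∃ C : ℝ, ∀ x ∈ K, ∀ e, IsPhiPlane φ x e → 0 ≤ A x e →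
      ∀ C' ≥ C, 0 < B x e + C' * A x e by
    obtain ⟨C, hC⟩ := H
    exact ⟨C, fun x hx e he => hC x hx e he (hA0 x hx e he)⟩
  refine hK.induction_on (p := fun s => ∃ C : ℝ, ∀ x ∈ s, ∀ e, IsPhiPlane φ x e → 0 ≤ A x e →
      ∀ C' ≥ C, 0 < B x e + C' * A x e) ⟨0, by simp⟩ ?_ ?_ ?_
  · rintro s t hst ⟨C, hC⟩
    exact ⟨C, fun x hx => hC x (hst hx)⟩
  · rintro s t ⟨C, hC⟩ ⟨D, hD⟩
    refine ⟨max C D, fun x hx e he he' C' hC' => ?_⟩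
    rcases hx with hx | hx
    · exact hC x hx e he he' C' ((le_max_left _ _).trans hC')
    · exact hD x hx e he he' C' ((le_max_right _ _).trans hC')
  · intro x hx
    obtain ⟨C, hC⟩ := exists_eventually_forall_isPhiPlane hφ (hA x hx) (hB x hx) (h x hx)
    exact ⟨_, mem_nhdsWithin_of_mem_nhds hC, C, fun y hy => hy⟩

/-- Positivity on `φ`-planes is an open condition on the base point. -/
theorem eventually_forall_isPhiPlane (hφ : IsSmoothForm φ) {x₀ : X}
    {B : Π x : X, (Fin p → TangentSpace 𝓘(ℝ, E) x) → ℝ} (hB : FrameContinuousAt B x₀)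
    (h : ∀ e, IsPhiPlane φ x₀ e → 0 < B x₀ e) :
    ∀ᶠ x in 𝓝 x₀, ∀ e, IsPhiPlane φ x e → 0 < B x e := by
  obtain ⟨C, hC⟩ := exists_eventually_forall_isPhiPlane (A := fun _ _ => 0) hφ
    (fun u₀ => continuousAt_const) hB (fun e he => Or.inr (h e he))
  filter_upwards [hC] with x hx e he
  simpa using hx e he le_rfl C le_rfl

/-- Positivity at all `φ`-planes over a set `K` persists over a neighborhood of `K`. -/
theorem exists_isOpen_forall_isPhiPlane_pos (hφ : IsSmoothForm φ) (hU : IsOpen U)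
    {B : Π x : X, (Fin p → TangentSpace 𝓘(ℝ, E) x) → ℝ} (hB : ∀ x ∈ U, FrameContinuousAt B x)
    {K : Set X} (hKU : K ⊆ U) (h : ∀ x ∈ K, ∀ e, IsPhiPlane φ x e → 0 < B x e) :
    ∃ V, IsOpen V ∧ K ⊆ V ∧ V ⊆ U ∧ ∀ x ∈ V, ∀ e, IsPhiPlane φ x e → 0 < B x e := by
  refine ⟨interior {x | ∀ e, IsPhiPlane φ x e → 0 < B x e} ∩ U, isOpen_interior.inter hU,
    fun x hx => ⟨?_, hKU hx⟩, inter_subset_right, fun x hx => interior_subset hx.1⟩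
  exact mem_interior_iff_mem_nhds.2 (eventually_forall_isPhiPlane hφ (hB x (hKU hx)) (h x hx))

end Compactness

/-! ### Hypersurfaces in charts -/

section ChartLines

variable {E : Type*} [NormedAddCommGroup E] [NormedSpace ℝ E]
  {X : Type*} [TopologicalSpace X] [ChartedSpace E X] {f g ρ : X → ℝ} {x : X}

theorem hasStrictFDerivAt_comp_chartAt_symm (hf : ContMDiffAt 𝓘(ℝ, E) 𝓘(ℝ, ℝ) ∞ f x) :
    HasStrictFDerivAt (f ∘ (chartAt E x).symm : E → ℝ) (mvfderiv 𝓘(ℝ, E) f x : E →L[ℝ] ℝ)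
      (chartAt E x x) := by
  have h1 : ContDiffAt ℝ ∞ (f ∘ (chartAt E x).symm : E → ℝ) (chartAt E x x) := by
    have := (contMDiffAt_iff.1 hf).2
    simpa only [mfld_simps, contDiffWithinAt_univ, Function.comp_def] using! this
  have h2 := h1.hasStrictFDerivAt (by simp)
  have h3 : (mvfderiv 𝓘(ℝ, E) f x : E →L[ℝ] ℝ) =
      fderiv ℝ (f ∘ (chartAt E x).symm : E → ℝ) (chartAt E x x) := by
    refine (hf.mdifferentiableAt (by simp)).mvfderiv.trans ?_
    simp only [mfld_simps, fderivWithin_univ]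
    rfl
  rw [h3]
  exact h2

/-- The straight line through `x` with velocity `v` in the preferred chart at `x`. -/
noncomputable def chartLine (x : X) (v : TangentSpace 𝓘(ℝ, E) x) (t : ℝ) : X :=
  letI w : E := v
  (chartAt E x).symm (chartAt E x x + t • w)

@[simp] theorem chartLine_zero (x : X) (v : TangentSpace 𝓘(ℝ, E) x) :
    chartLine x v 0 = x := by
  have h : ∀ w : E, (chartAt E x).symm (chartAt E x x + (0 : ℝ) • w) = x := fun w => by
    rw [zero_smul, add_zero, (chartAt E x).left_inv (mem_chart_source E x)]
  exact h v

theorem tendsto_chartLine (x : X) (v : TangentSpace 𝓘(ℝ, E) x) :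
    Tendsto (chartLine x v) (𝓝 0) (𝓝 x) := by
  have h : ∀ w : E, ContinuousAt (fun t : ℝ => (chartAt E x).symm (chartAt E x x + t • w)) 0 := by
    intro w
    have h1 : ContinuousAt (fun t : ℝ => chartAt E x x + t • w) 0 := by fun_prop
    have h2 : ContinuousAt (chartAt E x).symm (chartAt E x x + (0 : ℝ) • w) := by
      rw [zero_smul, add_zero]
      exact (chartAt E x).continuousAt_symm (mem_chart_target E x)
    exact ContinuousAt.comp (f := fun t : ℝ => chartAt E x x + t • w) h2 h1
  have h3 : Tendsto (chartLine x v) (𝓝 0) (𝓝 (chartLine x v 0)) := h v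
  rwa [chartLine_zero] at h3

theorem hasDerivAt_chartLine (hf : ContMDiffAt 𝓘(ℝ, E) 𝓘(ℝ, ℝ) ∞ f x)
    (v : TangentSpace 𝓘(ℝ, E) x) :
    HasDerivAt (fun t => f (chartLine x v t)) (mvfderiv 𝓘(ℝ, E) f x v) 0 := by
  have h : ∀ w : E, HasDerivAt (fun t : ℝ => f ((chartAt E x).symm (chartAt E x x + t • w)))
      ((mvfderiv 𝓘(ℝ, E) f x : E →L[ℝ] ℝ) w) 0 := by
    intro w
    have h1 : HasDerivAt (fun t : ℝ => chartAt E x x + t • w) w 0 := by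
      simpa using! ((hasDerivAt_id (0 : ℝ)).smul_const w).const_add (chartAt E x x)
    have h2 := (hasStrictFDerivAt_comp_chartAt_symm hf).hasFDerivAt
    have h3 : chartAt E x x + (0 : ℝ) • w = chartAt E x x := by simp
    rw [← h3] at h2
    exact h2.comp_hasDerivAt (0 : ℝ) h1
  exact h v

theorem eventually_chartLine_neg (hf : ContMDiffAt 𝓘(ℝ, E) 𝓘(ℝ, ℝ) ∞ f x) (h0 : f x = 0)
    {v : TangentSpace 𝓘(ℝ, E) x} (hv : mvfderiv 𝓘(ℝ, E) f x v < 0) :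
    ∀ᶠ t in 𝓝[>] (0 : ℝ), f (chartLine x v t) < 0 := by
  have h := (hasDerivAt_iff_tendsto_slope.1 (hasDerivAt_chartLine hf v)).eventually
    (gt_mem_nhds hv)
  have h' : ∀ᶠ t in 𝓝[>] (0 : ℝ), slope (fun t => f (chartLine x v t)) 0 t < 0 :=
    h.filter_mono (nhdsWithin_mono _ fun t ht => (ne_of_gt ht))
  filter_upwards [h', self_mem_nhdsWithin] with t ht htpos
  rw [slope_def_field, chartLine_zero, h0, sub_zero, sub_zero] at ht
  exact (div_neg_iff.1 ht).resolve_left (fun h => absurd h.2 (not_lt.2 (le_of_lt htpos))) |>.1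

/-- If the differential does not vanish at a zero of `f`, then `f` takes negative values near by. -/
theorem mem_closure_neg (hf : ContMDiffAt 𝓘(ℝ, E) 𝓘(ℝ, ℝ) ∞ f x) (h0 : f x = 0)
    (hne : mvfderiv 𝓘(ℝ, E) f x ≠ 0) : x ∈ closure {y | f y < 0} := by
  obtain ⟨v, hv⟩ : ∃ v, mvfderiv 𝓘(ℝ, E) f x v < 0 := by
    by_contra! h
    refine hne (ContinuousLinearMap.ext fun v => ?_)
    have h1 := h v
    have h2 := h (-v)
    rw [map_neg] at h2
    change mvfderiv 𝓘(ℝ, E) f x v = 0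
    linarith
  have h1 := eventually_chartLine_neg hf h0 hv
  exact mem_closure_of_tendsto ((tendsto_chartLine x v).mono_left nhdsWithin_le_nhds) h1

/-- If `g` vanishes near `x` on the hypersurface `{ρ = 0}`, then `dg` vanishes on `ker dρ` at `x`:
this is the Lagrange multiplier rule for the (constant) restriction of `g` to `{ρ = 0}`. -/
theorem mvfderiv_eq_zero_of_eq_zero [CompleteSpace E] (hρ : ContMDiffAt 𝓘(ℝ, E) 𝓘(ℝ, ℝ) ∞ ρ x)
    (hg : ContMDiffAt 𝓘(ℝ, E) 𝓘(ℝ, ℝ) ∞ g x) (h0 : ρ x = 0)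
    (hne : mvfderiv 𝓘(ℝ, E) ρ x ≠ 0) (h : ∀ᶠ y in 𝓝 x, ρ y = 0 → g y = 0)
    {v : TangentSpace 𝓘(ℝ, E) x} (hv : mvfderiv 𝓘(ℝ, E) ρ x v = 0) :
    mvfderiv 𝓘(ℝ, E) g x v = 0 := by
  have hxx : (chartAt E x).symm (chartAt E x x) = x :=
    (chartAt E x).left_inv (mem_chart_source E x)
  have hx0 : (ρ ∘ (chartAt E x).symm) (chartAt E x x) = 0 := by simp [hxx, h0]
  have hgx : g x = 0 := h.self_of_nhds h0
  have htend : Tendsto (chartAt E x).symm (𝓝 (chartAt E x x)) (𝓝 x) := by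
    simpa [hxx] using ((chartAt E x).continuousAt_symm (mem_chart_target E x)).tendsto
  have hext : IsLocalExtrOn (g ∘ (chartAt E x).symm)
      {y | (ρ ∘ (chartAt E x).symm) y = (ρ ∘ (chartAt E x).symm) (chartAt E x x)}
      (chartAt E x x) := by
    refine Or.inl ?_
    have h1 : ∀ᶠ y in 𝓝 (chartAt E x x), (ρ ∘ (chartAt E x).symm) y = 0 →
        (g ∘ (chartAt E x).symm) y = 0 := htend.eventually h
    filter_upwards [nhdsWithin_le_nhds h1, self_mem_nhdsWithin] with y hy hy'
    rw [hy (hy'.trans hx0)]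
    simp [hxx, hgx]
  obtain ⟨a, b, hab, hsum⟩ := hext.exists_multipliers_of_hasStrictFDerivAt_1d
    (hasStrictFDerivAt_comp_chartAt_symm hρ) (hasStrictFDerivAt_comp_chartAt_symm hg)
  have hsum' : ∀ w : TangentSpace 𝓘(ℝ, E) x,
      a * mvfderiv 𝓘(ℝ, E) ρ x w + b * mvfderiv 𝓘(ℝ, E) g x w = 0 :=
    fun w => DFunLike.congr_fun hsum w
  have hb : b ≠ 0 := by
    rintro rfl
    have ha : a ≠ 0 := fun ha => hab (by simp [ha])
    refine hne (ContinuousLinearMap.ext fun w => ?_)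
    have hw := hsum' w
    rw [zero_mul, add_zero] at hw
    exact (mul_eq_zero.1 hw).resolve_left ha
  have h2 := hsum' v
  rw [hv, mul_zero, zero_add] at h2
  exact (mul_eq_zero.1 h2).resolve_left hb

end ChartLines

/-! ### The geometry of the boundary -/

section Boundary

variable {E : Type*} [NormedAddCommGroup E] [NormedSpace ℝ E] [FiniteDimensional ℝ E]
  {X : Type*} [TopologicalSpace X] [ChartedSpace E X] [IsManifold 𝓘(ℝ, E) ∞ X]
  [RiemannianBundle (fun x : X => TangentSpace 𝓘(ℝ, E) x)]
  [IsContMDiffRiemannianBundle 𝓘(ℝ, E) ∞ E (fun x : X => TangentSpace 𝓘(ℝ, E) x)]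
  {Ω : Set X} {ρ ρ' : X → ℝ} {U U' : Set X} {x : X}

namespace IsDefiningFunctionOn

theorem contMDiffAt (h : IsDefiningFunctionOn (E := E) Ω ρ U) (hx : x ∈ U) :
    ContMDiffAt 𝓘(ℝ, E) 𝓘(ℝ, ℝ) ∞ ρ x :=
  h.smooth.contMDiffAt (h.isOpen.mem_nhds hx)

theorem mvfderiv_ne_zero (h : IsDefiningFunctionOn (E := E) Ω ρ U) (hx : x ∈ U)
    (hxΩ : x ∈ frontier Ω) : mvfderiv 𝓘(ℝ, E) ρ x ≠ 0 :=
  fun h0 => h.grad_ne_zero x ⟨hx, hxΩ⟩ (grad_eq_zero_iff.2 h0)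

theorem eq_zero (h : IsDefiningFunctionOn (E := E) Ω ρ U) (hΩ : IsOpen Ω) (hx : x ∈ U)
    (hxΩ : x ∈ frontier Ω) : ρ x = 0 := by
  rw [hΩ.frontier_eq] at hxΩ
  have h1 : 0 ≤ ρ x := not_lt.1 fun h' => hxΩ.2 ((h.mem_iff x hx).2 h')
  refine le_antisymm (not_lt.1 fun hpos => ?_) h1
  have h2 : ∀ᶠ y in 𝓝 x, 0 < ρ y :=
    (h.contMDiffAt hx).continuousAt.eventually (lt_mem_nhds hpos)
  obtain ⟨y, ⟨hy1, hy2⟩, hyΩ⟩ := mem_closure_iff_nhds.1 hxΩ.1 _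
    (inter_mem h2 (h.isOpen.mem_nhds hx))
  exact absurd ((h.mem_iff y hy2).1 hyΩ) (not_lt.2 (le_of_lt hy1))

/-- Near a boundary point, the zero set of a defining function consists of boundary points. -/
theorem eventually_mem_frontier (h : IsDefiningFunctionOn (E := E) Ω ρ U) (hΩ : IsOpen Ω)
    (hx : x ∈ U) (hxΩ : x ∈ frontier Ω) : ∀ᶠ y in 𝓝 x, ρ y = 0 → y ∈ frontier Ω := by
  have hc : ContinuousOn (fun y => (inner ℝ (grad (E := E) ρ y) (grad ρ y) : ℝ)) U :=
    (contMDiffOn_inner (contMDiffOn_grad h.isOpen h.smooth)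
      (contMDiffOn_grad h.isOpen h.smooth)).continuousOn
  have hne : (inner ℝ (grad (E := E) ρ x) (grad ρ x) : ℝ) ≠ 0 :=
    fun h0 => h.grad_ne_zero x ⟨hx, hxΩ⟩ (inner_self_eq_zero.1 h0)
  filter_upwards [(hc.continuousAt (h.isOpen.mem_nhds hx)).eventually_ne hne,
    h.isOpen.mem_nhds hx] with y hy hyU hy0
  have hd : mvfderiv 𝓘(ℝ, E) ρ y ≠ 0 := fun h0 => hy (by
    rw [grad_eq_zero_iff.2 h0, inner_zero_left])
  rw [hΩ.frontier_eq]
  refine ⟨?_, fun hyΩ => ?_⟩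
  · have h1 := mem_closure_neg (h.contMDiffAt hyU) hy0 hd
    refine mem_closure_iff_nhds.2 fun t ht => ?_
    obtain ⟨z, ⟨hz1, hz2⟩, hz⟩ := mem_closure_iff_nhds.1 h1 _
      (inter_mem ht (h.isOpen.mem_nhds hyU))
    exact ⟨z, hz1, (h.mem_iff z hz2).2 hz⟩
  · exact absurd ((h.mem_iff y hyU).1 hyΩ) (by rw [hy0]; exact lt_irrefl _)

theorem mvfderiv_eq_zero (h : IsDefiningFunctionOn (E := E) Ω ρ U)
    (h' : IsDefiningFunctionOn (E := E) Ω ρ' U') (hΩ : IsOpen Ω) (hx : x ∈ U) (hx' : x ∈ U')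
    (hxΩ : x ∈ frontier Ω) {v : TangentSpace 𝓘(ℝ, E) x} (hv : mvfderiv 𝓘(ℝ, E) ρ x v = 0) :
    mvfderiv 𝓘(ℝ, E) ρ' x v = 0 := by
  haveI : CompleteSpace E := FiniteDimensional.complete ℝ E
  refine mvfderiv_eq_zero_of_eq_zero (h.contMDiffAt hx) (h'.contMDiffAt hx') (h.eq_zero hΩ hx hxΩ)
    (h.mvfderiv_ne_zero hx hxΩ) ?_ hv
  filter_upwards [h.eventually_mem_frontier hΩ hx hxΩ, h'.isOpen.mem_nhds hx'] with y hy hyU hy0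
  exact h'.eq_zero hΩ hyU (hy hy0)

theorem isTangentToBoundary_iff (h : IsDefiningFunctionOn (E := E) Ω ρ U) (hΩ : IsOpen Ω)
    (hx : x ∈ U) (hxΩ : x ∈ frontier Ω) {v : TangentSpace 𝓘(ℝ, E) x} :
    IsTangentToBoundary Ω x v ↔ mvfderiv 𝓘(ℝ, E) ρ x v = 0 :=
  ⟨fun ⟨_, _, hx', h', hv⟩ => h'.mvfderiv_eq_zero h hΩ hx' hx hxΩ hv, fun hv => ⟨ρ, U, hx, h, hv⟩⟩

/-- Vectors that point into `Ω` according to one defining function do so according to all. -/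
theorem mvfderiv_neg (h : IsDefiningFunctionOn (E := E) Ω ρ U)
    (h' : IsDefiningFunctionOn (E := E) Ω ρ' U') (hΩ : IsOpen Ω) (hx : x ∈ U) (hx' : x ∈ U')
    (hxΩ : x ∈ frontier Ω) {v : TangentSpace 𝓘(ℝ, E) x} (hv : mvfderiv 𝓘(ℝ, E) ρ x v < 0) :
    mvfderiv 𝓘(ℝ, E) ρ' x v < 0 := by
  have hne : mvfderiv 𝓘(ℝ, E) ρ' x v ≠ 0 := fun h0 =>
    hv.ne (h'.mvfderiv_eq_zero h hΩ hx' hx hxΩ h0)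
  refine lt_of_le_of_ne (not_lt.1 fun hpos => ?_) hne
  -- along the chart line with velocity `v` both `ρ < 0` and `-ρ' < 0` hold for small times
  have h1 := eventually_chartLine_neg (h.contMDiffAt hx) (h.eq_zero hΩ hx hxΩ) hv
  have h2 := hasDerivAt_chartLine (h'.contMDiffAt hx') v
  have h3 : ∀ᶠ t in 𝓝[>] (0 : ℝ), 0 < slope (fun t => ρ' (chartLine x v t)) 0 t :=
    ((hasDerivAt_iff_tendsto_slope.1 h2).eventually (lt_mem_nhds hpos)).filter_mono
      (nhdsWithin_mono _ fun t ht => (ne_of_gt ht))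
  have h4 : ∀ᶠ t in 𝓝[>] (0 : ℝ), chartLine x v t ∈ U ∩ U' :=
    ((tendsto_chartLine x v).eventually
      ((h.isOpen.inter h'.isOpen).mem_nhds ⟨hx, hx'⟩)).filter_mono nhdsWithin_le_nhds
  obtain ⟨t, ht1, ht3, ⟨htU, htU'⟩, ht0⟩ :=
    (h1.and (h3.and (h4.and self_mem_nhdsWithin))).exists
  have ht : (0 : ℝ) < t := ht0
  rw [slope_def_field, chartLine_zero, h'.eq_zero hΩ hx' hxΩ, sub_zero, sub_zero] at ht3
  have h5 : ρ' (chartLine x v t) < 0 :=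
    (h'.mem_iff _ htU').1 ((h.mem_iff _ htU).2 ht1)
  exact absurd (div_neg_of_neg_of_pos h5 ht) (not_lt.2 ht3.le)

/-- The unit vector `∇ρ / |∇ρ|` does not depend on the defining function. -/
theorem normalized_grad_eq (h : IsDefiningFunctionOn (E := E) Ω ρ U)
    (h' : IsDefiningFunctionOn (E := E) Ω ρ' U') (hΩ : IsOpen Ω) (hx : x ∈ U) (hx' : x ∈ U')
    (hxΩ : x ∈ frontier Ω) :
    ‖grad (E := E) ρ' x‖⁻¹ • grad (E := E) ρ' x = ‖grad (E := E) ρ x‖⁻¹ • grad ρ x := by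
  set n := grad (E := E) ρ x with hn
  set n' := grad (E := E) ρ' x with hn'
  have hn0 : n ≠ 0 := h.grad_ne_zero x ⟨hx, hxΩ⟩
  have hn0' : n' ≠ 0 := h'.grad_ne_zero x ⟨hx', hxΩ⟩
  have hnn : (0 : ℝ) < inner ℝ n n := real_inner_self_pos.2 hn0
  set c : ℝ := inner ℝ n' n / inner ℝ n n with hc
  -- the component of `n'` orthogonal to `n` is tangent to the boundary, hence orthogonal to `n'`
  have hw1 : inner ℝ n (n' - c • n) = (0 : ℝ) := by
    rw [inner_sub_right, inner_smul_right, real_inner_comm, hc]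
    field_simp
    ring
  have hw2 : inner ℝ n' (n' - c • n) = (0 : ℝ) := by
    rw [hn', inner_grad]
    refine h.mvfderiv_eq_zero h' hΩ hx hx' hxΩ ?_
    rw [← inner_grad, ← hn', hw1]
  have hw : n' = c • n := by
    rw [← sub_eq_zero, ← inner_self_eq_zero (𝕜 := ℝ)]
    nth_rewrite 1 [inner_sub_left]
    rw [hw2, inner_smul_left, hw1, mul_zero, sub_zero]
  have hcpos : 0 < c := by
    have h1 : mvfderiv 𝓘(ℝ, E) ρ' x (-n) < 0 := by
      refine h.mvfderiv_neg h' hΩ hx hx' hxΩ ?_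
      rw [map_neg, ← inner_grad, ← hn]
      linarith
    rw [map_neg, ← inner_grad, ← hn', neg_lt_zero] at h1
    exact div_pos h1 hnn
  rw [hw, norm_smul, Real.norm_of_nonneg hcpos.le, smul_smul, mul_inv_rev]
  congr 1
  field_simp

theorem outwardNormal_eq (h : IsDefiningFunctionOn (E := E) Ω ρ U) (hΩ : IsOpen Ω)
    (hx : x ∈ U) (hxΩ : x ∈ frontier Ω) :
    outwardNormal (E := E) Ω x = ‖grad (E := E) ρ x‖⁻¹ • grad ρ x := by
  have hex : ∃ n, IsOutwardUnitNormal (E := E) Ω x n := ⟨_, ρ, U, hx, h, rfl⟩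
  rw [outwardNormal, dif_pos hex]
  obtain ⟨ρ', U', hx', h', hn⟩ := hex.choose_spec
  rw [hn]
  exact h.normalized_grad_eq h' hΩ hx hx' hxΩ

/-- Tangent vectors of the boundary extend to tangent fields, so that the second fundamental form
does not take its junk value. -/
theorem exists_isTangentExtension (h : IsDefiningFunctionOn (E := E) Ω ρ U)
    (hx : x ∈ U) (hxΩ : x ∈ frontier Ω) {w : TangentSpace 𝓘(ℝ, E) x}
    (hw : mvfderiv 𝓘(ℝ, E) ρ x w = 0) : ∃ W, IsTangentExtension (E := E) Ω x w W := by
  obtain ⟨u, rfl⟩ := exists_coordField_eq (mem_chart_source E x) w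
  -- project the coordinate field orthogonally to the level sets of `ρ`
  let G : X → ℝ := fun y => inner ℝ (grad (E := E) ρ y) (grad ρ y)
  let c : X → ℝ := fun y => inner ℝ (grad (E := E) ρ y) (coordField E x u y) / G y
  have hgU := contMDiffOn_grad h.isOpen h.smooth
  have hG : ContMDiffOn 𝓘(ℝ, E) 𝓘(ℝ, ℝ) ∞ G U := contMDiffOn_inner hgU hgU
  have hGx : G x ≠ 0 := fun h0 => h.grad_ne_zero x ⟨hx, hxΩ⟩ (inner_self_eq_zero.1 h0)
  obtain ⟨S, hSsub, hSo, hxS⟩ : ∃ S ⊆ {y | G y ≠ 0} ∩ U ∩ (chartAt E x).source,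
      IsOpen S ∧ x ∈ S := by
    refine mem_nhds_iff.1 (inter_mem (inter_mem ?_ (h.isOpen.mem_nhds hx))
      ((chartAt E x).open_source.mem_nhds (mem_chart_source E x)))
    exact (hG.continuousOn.continuousAt (h.isOpen.mem_nhds hx)).eventually_ne hGx
  have hSU : S ⊆ U := fun y hy => (hSsub hy).1.2
  have hF := (contMDiffOn_coordField x u).mono (fun y hy => (hSsub hy).2 : S ⊆ _)
  have hc : ContMDiffOn 𝓘(ℝ, E) 𝓘(ℝ, ℝ) ∞ c S :=
    (contMDiffOn_inner (hgU.mono hSU) hF).div₀ (hG.mono hSU) fun y hy => (hSsub hy).1.1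
  refine ⟨fun y => coordField E x u y - c y • grad ρ y, ?_, S, hSo, hxS, ?_, ?_⟩
  · have : c x = 0 := by simp only [c, inner_grad, hw, zero_div]
    simp [this]
  · exact hF.sub_section (hc.smul_section (hgU.mono hSU))
  · intro y hy
    refine ⟨ρ, U, hSU hy.1, h, ?_⟩
    have hGy : G y ≠ 0 := (hSsub hy.1).1.1
    rw [← inner_grad, inner_sub_right, inner_smul_right]
    change _ - inner ℝ (grad (E := E) ρ y) (coordField E x u y) / G y * G y = 0
    rw [div_mul_cancel₀ _ hGy, sub_self]

/-- The second fundamental form is the Hessian of a defining function, up to the factor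
`-1 / |∇ρ|`: differentiate the identity `⟪W, ∇ρ⟫ = 0`, which holds along the boundary. -/
theorem secondFundamentalForm_eq (h : IsDefiningFunctionOn (E := E) Ω ρ U) (hΩ : IsOpen Ω)
    (hx : x ∈ U) (hxΩ : x ∈ frontier Ω) {v w : TangentSpace 𝓘(ℝ, E) x}
    (hv : mvfderiv 𝓘(ℝ, E) ρ x v = 0) (hw : mvfderiv 𝓘(ℝ, E) ρ x w = 0) :
    secondFundamentalForm (E := E) Ω x v w =
      -(‖grad (E := E) ρ x‖⁻¹ * inner ℝ (hessian ρ x v) w) := by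
  haveI : CompleteSpace E := FiniteDimensional.complete ℝ E
  have hex := h.exists_isTangentExtension hx hxΩ hw
  rw [secondFundamentalForm, dif_pos hex, h.outwardNormal_eq hΩ hx hxΩ, inner_smul_right]
  obtain ⟨hWx, S, hSo, hxS, hWs, hWt⟩ := hex.choose_spec
  generalize hex.choose = W at *
  have hW : ContMDiffAt 𝓘(ℝ, E) (𝓘(ℝ, E).prod 𝓘(ℝ, E)) ∞ (T% W) x :=
    hWs.contMDiffAt (hSo.mem_nhds hxS)
  have hg : ContMDiffAt 𝓘(ℝ, E) (𝓘(ℝ, E).prod 𝓘(ℝ, E)) ∞ (T% (grad (E := E) ρ)) x :=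
    (contMDiffOn_grad h.isOpen h.smooth).contMDiffAt (h.isOpen.mem_nhds hx)
  have h0 : mvfderiv 𝓘(ℝ, E) (fun y => (inner ℝ (W y) (grad (E := E) ρ y) : ℝ)) x v = 0 := by
    refine mvfderiv_eq_zero_of_eq_zero (h.contMDiffAt hx) (contMDiffAt_inner le_rfl hW hg)
      (h.eq_zero hΩ hx hxΩ) (h.mvfderiv_ne_zero hx hxΩ) ?_ hv
    filter_upwards [h.eventually_mem_frontier hΩ hx hxΩ, h.isOpen.mem_nhds hx,
      hSo.mem_nhds hxS] with y hy hyU hyS hy0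
    rw [inner_grad']
    exact (h.isTangentToBoundary_iff hΩ hyU (hy hy0)).1 (hWt y ⟨hyS, hy hy0⟩)
  obtain ⟨u, hu⟩ := exists_coordField_eq (mem_chart_source E x) v
  have hV : MDiffAt (T% (coordField E x u)) x :=
    ((contMDiffOn_coordField x u).contMDiffAt ((chartAt E x).open_source.mem_nhds
      (mem_chart_source E x))).mdifferentiableAt (by simp)
  have hm := leviCivita_metric hV (hW.mdifferentiableAt (by simp))
    (hg.mdifferentiableAt (by simp))
  rw [hu, h0, hWx] at hm
  have h1 : (inner ℝ (leviCivita E X W x v) (grad ρ x) : ℝ) = - inner ℝ (hessian ρ x v) w := by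
    rw [real_inner_comm w (hessian ρ x v)]
    exact eq_neg_of_add_eq_zero_left hm.symm
  rw [h1, mul_neg]

end IsDefiningFunctionOn

end Boundary

/-! ### Auxiliary functions of one variable -/

section OneVariable

/-- A convex reparametrization: `η` is constant to the left of `-δ`, increasing to the right, keeps
the sign of its argument and is convex enough that `η'' ≥ C η'`. -/
theorem exists_convex_reparametrization (C : ℝ) {δ : ℝ} (hδ : 0 < δ) :
    ∃ η : ℝ → ℝ, ContDiff ℝ ∞ η ∧ (∀ s < 0, η s < 0) ∧ (∀ s, 0 ≤ s → 0 ≤ η s) ∧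
      (∀ s ≤ -δ, deriv η s = 0) ∧ (∀ s, -δ < s → 0 < deriv η s) ∧
      ∀ s, C * deriv η s ≤ deriv (deriv η) s := by
  let S : ℝ → ℝ := fun s => expNegInvGlue (s + δ)
  have hS : ContDiff ℝ ∞ S := expNegInvGlue.contDiff.comp (contDiff_id.add contDiff_const)
  have hSmono : Monotone S := fun s t hst => expNegInvGlue.monotone (by linarith)
  let g : ℝ → ℝ := fun s => Real.exp (C * s) * S s
  have hg : ContDiff ℝ ∞ g := (by fun_prop : ContDiff ℝ ∞ fun s => Real.exp (C * s)).mul hS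
  have hg0 : ∀ s, 0 ≤ g s := fun s => mul_nonneg (Real.exp_pos _).le (expNegInvGlue.nonneg _)
  have hgpos : ∀ s, -δ < s → 0 < g s := fun s hs =>
    mul_pos (Real.exp_pos _) (expNegInvGlue.pos_of_pos (by linarith))
  let η : ℝ → ℝ := fun s => ∫ t in (0 : ℝ)..s, g t
  have hη : ∀ s, HasDerivAt η (g s) s := fun s =>
    intervalIntegral.integral_hasDerivAt_right (hg.continuous.intervalIntegrable _ _)
      (hg.continuous.stronglyMeasurableAtFilter _ _) hg.continuous.continuousAt
  have hderiv : deriv η = g := funext fun s => (hη s).deriv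
  have hη0 : η 0 = 0 := intervalIntegral.integral_same
  have hmono : Monotone η := monotone_of_deriv_nonneg (fun s => (hη s).differentiableAt)
    (fun s => by rw [hderiv]; exact hg0 s)
  have hstrict : StrictMonoOn η (Ici (-δ)) := by
    refine strictMonoOn_of_deriv_pos (convex_Ici _)
      (fun s _ => (hη s).continuousAt.continuousWithinAt) fun s hs => ?_
    rw [interior_Ici] at hs
    rw [hderiv]
    exact hgpos s hs
  refine ⟨η, contDiff_infty_iff_deriv.2 ⟨fun s => (hη s).differentiableAt, by rwa [hderiv]⟩,
    fun s hs => ?_, fun s hs => hη0 ▸ hmono hs, fun s hs => ?_, fun s hs => ?_, fun s => ?_⟩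
  · have h1 : η (max s (-δ)) < η 0 := hstrict (mem_Ici.2 (le_max_right _ _)) (by simpa using hδ.le)
      (max_lt hs (by linarith))
    exact (hmono (le_max_left _ _)).trans_lt (hη0 ▸ h1)
  · rw [hderiv]
    simp only [g, S, expNegInvGlue.zero_of_nonpos (by linarith : s + δ ≤ 0), mul_zero]
  · rw [hderiv]; exact hgpos s hs
  · rw [hderiv]
    have h1 : HasDerivAt (fun s => Real.exp (C * s)) (Real.exp (C * s) * C) s := by
      simpa using ((hasDerivAt_id s).const_mul C).exp
    have h2 : HasDerivAt S (deriv S s) s := (hS.differentiable (by simp) s).hasDerivAt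
    have h5 : deriv g s = Real.exp (C * s) * C * S s + Real.exp (C * s) * deriv S s :=
      (h1.mul h2).deriv
    rw [h5]
    have h3 : 0 ≤ deriv S s := hSmono.deriv_nonneg
    have h4 : 0 ≤ Real.exp (C * s) * deriv S s := mul_nonneg (Real.exp_pos _).le h3
    change C * (Real.exp (C * s) * S s) ≤ _
    linarith [mul_left_comm C (Real.exp (C * s)) (S s),
      mul_assoc (Real.exp (C * s)) C (S s)]

/-- A smooth function with values in `[0, ∞)` that is `1` to the left of `-δ / 2` and `0` to the
right of `-δ / 4`. -/
theorem exists_cutoff {δ : ℝ} (hδ : 0 < δ) :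
    ∃ χ : ℝ → ℝ, ContDiff ℝ ∞ χ ∧ (∀ s, 0 ≤ χ s) ∧ (∀ s ≤ -δ / 2, χ s = 1) ∧
      ∀ s, -δ / 4 ≤ s → χ s = 0 := by
  refine ⟨fun s => Real.smoothTransition (-(4 / δ) * s - 1), ?_, fun s =>
    Real.smoothTransition.nonneg _, fun s hs => Real.smoothTransition.one_of_one_le ?_,
    fun s hs => Real.smoothTransition.zero_of_nonpos ?_⟩
  · exact Real.smoothTransition.contDiff.comp (by fun_prop)
  · have h : 4 / δ * s ≤ 4 / δ * (-δ / 2) := mul_le_mul_of_nonneg_left hs (by positivity)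
    have h' : 4 / δ * (-δ / 2) = -2 := by field_simp; norm_num
    linarith
  · have h : 4 / δ * (-δ / 4) ≤ 4 / δ * s := mul_le_mul_of_nonneg_left hs (by positivity)
    have h' : 4 / δ * (-δ / 4) = -1 := by field_simp
    linarith

end OneVariable

/-! ### Existence of a global defining function -/

section Global

variable {E : Type*} [NormedAddCommGroup E] [NormedSpace ℝ E] [FiniteDimensional ℝ E]
  {X : Type*} [TopologicalSpace X] [ChartedSpace E X] [IsManifold 𝓘(ℝ, E) ∞ X]
  [RiemannianBundle (fun x : X => TangentSpace 𝓘(ℝ, E) x)]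
  [IsContMDiffRiemannianBundle 𝓘(ℝ, E) ∞ E (fun x : X => TangentSpace 𝓘(ℝ, E) x)]
  {Ω : Set X} {ρ : X → ℝ} {U : Set X}

theorem HasSmoothBoundary.exists_isDefiningFunctionOn (hΩ : HasSmoothBoundary E Ω) (x : X) :
    ∃ (ρ : X → ℝ) (U : Set X), x ∈ U ∧ IsDefiningFunctionOn (E := E) Ω ρ U := by
  by_cases hf : x ∈ frontier Ω
  · exact hΩ.2 x hf
  by_cases hx : x ∈ Ω
  · refine ⟨fun _ => -1, Ω, hx, hΩ.1, contMDiffOn_const, fun y hy => by simp [hy], ?_⟩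
    rintro y ⟨hy, hy'⟩
    rw [hΩ.1.frontier_eq] at hy'
    exact absurd hy hy'.2
  · have hx' : x ∈ (closure Ω)ᶜ := fun h => hf (by rw [hΩ.1.frontier_eq]; exact ⟨h, hx⟩)
    refine ⟨fun _ => 1, (closure Ω)ᶜ, hx', isClosed_closure.isOpen_compl, contMDiffOn_const,
      fun y hy => ?_, ?_⟩
    · have : y ∉ Ω := fun h => hy (subset_closure h)
      simp only [this, false_iff, not_lt]
      norm_num
    · rintro y ⟨hy, hy'⟩
      exact absurd (frontier_subset_closure hy') hy

/-- An open set with smooth boundary has a global defining function: patch local ones together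
with a partition of unity. The gradient of the result does not vanish on the boundary because the
differentials of all local defining functions are negative on a common inward vector. -/
theorem HasSmoothBoundary.exists_global [T2Space X] [SecondCountableTopology X]
    (hΩ : HasSmoothBoundary E Ω) : ∃ ρ : X → ℝ, IsDefiningFunctionOn (E := E) Ω ρ univ := by
  haveI : LocallyCompactSpace X := ChartedSpace.locallyCompactSpace E X
  choose r U hU hr using hΩ.exists_isDefiningFunctionOn
  obtain ⟨θ, hθ⟩ := SmoothPartitionOfUnity.exists_isSubordinate 𝓘(ℝ, E) (s := univ) isClosed_univ U
    (fun x => (hr x).isOpen) (fun x _ => mem_iUnion.2 ⟨x, hU x⟩)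
  have hsupp : ∀ i y, θ i y ≠ 0 → y ∈ U i := fun i y h => hθ i (subset_closure h)
  have hsmooth : ContMDiff 𝓘(ℝ, E) 𝓘(ℝ, ℝ) ∞ fun y => ∑ᶠ i, θ i y • r i y :=
    hθ.contMDiff_finsum_smul (fun i => (hr i).isOpen) fun i => (hr i).smooth
  refine ⟨fun y => ∑ᶠ i, θ i y • r i y, isOpen_univ, hsmooth.contMDiffOn, fun y _ => ⟨fun hy => ?_,
    fun hy => ?_⟩, ?_⟩
  · exact θ.finsum_smul_mem_convex (mem_univ y)
      (fun i hi => ((hr i).mem_iff y (hsupp i y hi)).1 hy) (convex_Iio (0 : ℝ))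
  · by_contra hyΩ
    have : (∑ᶠ i, θ i y • r i y) ∈ Ici (0 : ℝ) := θ.finsum_smul_mem_convex (mem_univ y)
      (fun i hi => not_lt.1 fun h => hyΩ (((hr i).mem_iff y (hsupp i y hi)).2 h))
      (convex_Ici (0 : ℝ))
    exact absurd hy (not_lt.2 this)
  · rintro x ⟨-, hx⟩ h0
    rw [grad_eq_zero_iff] at h0
    set v : TangentSpace 𝓘(ℝ, E) x := -grad (E := E) (r x) x with hv
    have hvx : mvfderiv 𝓘(ℝ, E) (r x) x v < 0 := by
      rw [hv, map_neg, ← inner_grad, neg_lt_zero]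
      exact real_inner_self_pos.2 ((hr x).grad_ne_zero x ⟨hU x, hx⟩)
    have hneg : ∀ i, x ∈ U i → mvfderiv 𝓘(ℝ, E) (r i) x v < 0 := fun i hi =>
      (hr x).mvfderiv_neg (hr i) hΩ.1 (hU x) hi hx hvx
    have hUi : ∀ i ∈ θ.fintsupport x, x ∈ U i := fun i hi =>
      hθ i ((θ.mem_fintsupport_iff x i).1 hi)
    have hd1 := hasDerivAt_chartLine (hsmooth.contMDiffAt (x := x)) v
    have hd2 : HasDerivAt
        (fun t => ∑ i ∈ θ.fintsupport x, θ i (chartLine x v t) * r i (chartLine x v t))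
        (∑ i ∈ θ.fintsupport x, θ i x * mvfderiv 𝓘(ℝ, E) (r i) x v) 0 := by
      refine HasDerivAt.fun_sum fun i hi => ?_
      have h1 := hasDerivAt_chartLine ((θ i).contMDiff.contMDiffAt (x := x)) v
      have h2 := hasDerivAt_chartLine ((hr i).contMDiffAt (hUi i hi)) v
      have h3 := h1.mul h2
      simp only [chartLine_zero, (hr i).eq_zero hΩ.1 (hUi i hi) hx, mul_zero, zero_add] at h3
      exact h3
    have heq : (fun t => ∑ᶠ i, θ i (chartLine x v t) • r i (chartLine x v t)) =ᶠ[𝓝 0]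
        fun t => ∑ i ∈ θ.fintsupport x, θ i (chartLine x v t) * r i (chartLine x v t) := by
      filter_upwards [(tendsto_chartLine x v).eventually (θ.eventually_finsupport_subset x)]
        with t ht
      rw [← θ.sum_finsupport_smul_eq_finsum]
      refine Finset.sum_subset ht fun i _ hi => ?_
      rw [θ.mem_finsupport, Function.mem_support, not_not] at hi
      rw [hi, zero_smul]
    have h1 := (hd2.congr_of_eventuallyEq heq).unique hd1
    rw [h0] at h1
    obtain ⟨i, hi⟩ := θ.exists_pos_of_mem (mem_univ x)
    have hlt : (∑ i ∈ θ.fintsupport x, θ i x * mvfderiv 𝓘(ℝ, E) (r i) x v) < 0 := by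
      refine Finset.sum_neg' (fun j hj => mul_nonpos_of_nonneg_of_nonpos (θ.nonneg j x)
        (hneg j (hUi j hj)).le) ⟨i, ?_, mul_neg_of_pos_of_neg hi (hneg i (hsupp i x hi.ne'))⟩
      exact (θ.mem_fintsupport_iff x i).2 (subset_closure hi.ne')
    exact hlt.ne h1

end Global

/-! ### The trace of the second fundamental form -/

section Trace

variable {E : Type*} [NormedAddCommGroup E] [NormedSpace ℝ E] [FiniteDimensional ℝ E]
  {X : Type*} [TopologicalSpace X] [ChartedSpace E X] [IsManifold 𝓘(ℝ, E) ∞ X]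
  [RiemannianBundle (fun x : X => TangentSpace 𝓘(ℝ, E) x)]
  [IsContMDiffRiemannianBundle 𝓘(ℝ, E) ∞ E (fun x : X => TangentSpace 𝓘(ℝ, E) x)]
  {p : ℕ} {φ : Π x : X, TangentSpace 𝓘(ℝ, E) x [⋀^Fin p]→L[ℝ] ℝ}
  {Ω : Set X} {ρ : X → ℝ} {U : Set X}

/-- The signs are opposite because on a tangential `φ`-plane the trace of the second fundamental
form is `-1 / |∇ρ|` times the `φ`-Hessian of `ρ`. -/
theorem IsDefiningFunctionOn.traceSecondFundamentalForm_neg_iff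
    (h : IsDefiningFunctionOn (E := E) Ω ρ U) (hΩ : IsOpen Ω) (hφ : IsCalibration φ) {x : X}
    (hx : x ∈ U) (hxΩ : x ∈ frontier Ω) {e : Fin p → TangentSpace 𝓘(ℝ, E) x}
    (he : IsTangentialPhiPlane φ Ω x e) :
    traceSecondFundamentalForm Ω x e < 0 ↔ 0 < phiHessian φ ρ x e := by
  have hn : 0 < ‖grad (E := E) ρ x‖⁻¹ :=
    inv_pos.2 (norm_pos_iff.2 (h.grad_ne_zero x ⟨hx, hxΩ⟩))
  have ht := fun k => (h.isTangentToBoundary_iff hΩ hx hxΩ).1 (he.2 k)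
  have h1 : traceSecondFundamentalForm Ω x e = -(‖grad (E := E) ρ x‖⁻¹ * phiHessian φ ρ x e) := by
    rw [he.1.phiHessian_eq hφ, hessianTrace, Finset.mul_sum, ← Finset.sum_neg_distrib]
    exact Finset.sum_congr rfl fun k _ => h.secondFundamentalForm_eq hΩ hx hxΩ (ht k) (ht k)
  rw [h1, neg_lt_zero, mul_pos_iff_of_pos_left hn]

end Trace

/-! ### Strictly plurisubharmonic defining functions -/

section Extension

variable {E : Type*} [NormedAddCommGroup E] [NormedSpace ℝ E] [FiniteDimensional ℝ E]
  {X : Type*} [TopologicalSpace X] [ChartedSpace E X] [IsManifold 𝓘(ℝ, E) ∞ X]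
  [RiemannianBundle (fun x : X => TangentSpace 𝓘(ℝ, E) x)]
  [IsContMDiffRiemannianBundle 𝓘(ℝ, E) ∞ E (fun x : X => TangentSpace 𝓘(ℝ, E) x)]
  {p : ℕ} {φ : Π x : X, TangentSpace 𝓘(ℝ, E) x [⋀^Fin p]→L[ℝ] ℝ}
  {Ω : Set X} {ρ : X → ℝ} {U : Set X}

/-- A defining function of a strictly `φ`-convex boundary satisfies, near the boundary,
`tr_ξ (Hess ρ + C dρ ⊗ dρ) > 0` for all `φ`-planes `ξ`, tangential or not. -/
theorem exists_hessianTrace_add_pos (hφ : IsSmoothForm φ) (hΩc : IsCompact (closure Ω))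
    (hcl : closure Ω ⊆ U) (h : IsDefiningFunctionOn (E := E) Ω ρ U)
    (hpos : ∀ x ∈ frontier Ω, ∀ e : Fin p → TangentSpace 𝓘(ℝ, E) x, IsPhiPlane φ x e →
      (∀ k, mvfderiv 𝓘(ℝ, E) ρ x (e k) = 0) → 0 < hessianTrace ρ x e) :
    ∃ (C : ℝ) (N : Set X), IsOpen N ∧ frontier Ω ⊆ N ∧ ∀ x ∈ N, ∀ e, IsPhiPlane φ x e →
      0 < hessianTrace ρ x e + C * dSqTrace ρ x e := by
  have hK : IsCompact (frontier Ω) :=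
    hΩc.of_isClosed_subset isClosed_frontier frontier_subset_closure
  have hA : ∀ x ∈ U, FrameContinuousAt (E := E) (p := p) (dSqTrace ρ) x :=
    fun x hx => frameContinuousAt_dSqTrace h.isOpen h.smooth hx
  have hB : ∀ x ∈ U, FrameContinuousAt (E := E) (p := p) (hessianTrace ρ) x :=
    fun x hx => frameContinuousAt_hessianTrace h.isOpen h.smooth hx
  have hfU : frontier Ω ⊆ U := frontier_subset_closure.trans hcl
  obtain ⟨C, hC⟩ := exists_forall_isPhiPlane_of_isCompact hφ hK (fun x hx => hA x (hfU hx))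
    (fun x hx => hB x (hfU hx)) (fun x _ e _ => dSqTrace_nonneg ρ x e) (fun x hx e he => by
      rcases (dSqTrace_nonneg ρ x e).lt_or_eq with h1 | h1
      · exact Or.inl h1
      · exact Or.inr (hpos x hx e he (dSqTrace_eq_zero_iff.1 h1.symm)))
  obtain ⟨N, hN, hKN, -, hNpos⟩ := exists_isOpen_forall_isPhiPlane_pos hφ h.isOpen
    (B := fun x e => hessianTrace ρ x e + C * dSqTrace ρ x e)
    (fun x hx u₀ => (hB x hx u₀).add (continuousAt_const.mul (hA x hx u₀))) hfU
    (fun x hx e he => hC x hx e he C le_rfl)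
  exact ⟨C, N, hN, hKN, hNpos⟩

/-- A neighborhood `N` of the boundary contains a collar `{-δ ≤ ρ} ∩ closure Ω`. -/
theorem exists_collar_subset {N : Set X} (hΩ : IsOpen Ω) (hΩc : IsCompact (closure Ω))
    (hcl : closure Ω ⊆ U) (h : IsDefiningFunctionOn (E := E) Ω ρ U) (hN : IsOpen N)
    (hfN : frontier Ω ⊆ N) : ∃ δ : ℝ, 0 < δ ∧ ∀ x ∈ closure Ω, -δ ≤ ρ x → x ∈ N := by
  have hK : IsCompact (closure Ω \ N) := hΩc.diff hN
  have hneg : ∀ x ∈ closure Ω \ N, ρ x < 0 := by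
    rintro x ⟨hx, hxN⟩
    refine (h.mem_iff x (hcl hx)).1 (by_contra fun hxΩ => hxN (hfN ?_))
    rw [hΩ.frontier_eq]
    exact ⟨hx, hxΩ⟩
  rcases (closure Ω \ N).eq_empty_or_nonempty with h0 | h0
  · refine ⟨1, one_pos, fun x hx _ => by_contra fun hxN => ?_⟩
    have : x ∈ closure Ω \ N := ⟨hx, hxN⟩
    rw [h0] at this
    exact this
  · obtain ⟨x₀, hx₀, hmax⟩ := hK.exists_isMaxOn h0
      (h.smooth.continuousOn.mono (sdiff_subset.trans hcl))
    have h1 := hneg x₀ hx₀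
    refine ⟨-ρ x₀ / 2, by linarith, fun x hx hxρ => by_contra fun hxN => ?_⟩
    have : ρ x ≤ ρ x₀ := hmax ⟨hx, hxN⟩
    linarith

/-- The defining function `K η(ρ) + χ(ρ) f`: near the boundary the first summand dominates and
`χ(ρ)` vanishes next to the boundary; in the interior `η(ρ)` is plurisubharmonic and `χ(ρ) f = f` is
strictly so. -/
theorem exists_strictlyPSH_definingFunction (hφ : IsCalibration φ)
    (hX : IsStrictlyConvexManifold φ) (hΩ : IsOpen Ω) (hΩc : IsCompact (closure Ω))
    (hcl : closure Ω ⊆ U) (h : IsDefiningFunctionOn (E := E) Ω ρ U)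
    (hpos : ∀ x ∈ frontier Ω, ∀ e : Fin p → TangentSpace 𝓘(ℝ, E) x, IsPhiPlane φ x e →
      (∀ k, mvfderiv 𝓘(ℝ, E) ρ x (e k) = 0) → 0 < hessianTrace ρ x e) :
    ∃ ψ : X → ℝ, IsDefiningFunction E Ω ψ ∧
      ∃ V : Set X, IsOpen V ∧ closure Ω ⊆ V ∧ IsStrictlyPSHOn φ ψ V := by
  obtain ⟨C, N, hN, hfN, hNpos⟩ := exists_hessianTrace_add_pos hφ.smooth hΩc hcl h hpos
  obtain ⟨δ, hδ, hδN⟩ := exists_collar_subset hΩ hΩc hcl h hN hfN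
  obtain ⟨η, hη, hηneg, hηnonneg, hη0, hηpos, hηconv⟩ := exists_convex_reparametrization C hδ
  obtain ⟨χ, hχ, hχ0, hχ1, hχz⟩ := exists_cutoff hδ
  obtain ⟨f₀, ⟨hf₀s, hf₀p⟩, -⟩ := hX
  obtain ⟨c, hc⟩ := hΩc.bddAbove_image (hf₀s.continuousOn.mono (subset_univ _))
  have hUo := h.isOpen
  -- normalize the exhaustion function to be nonpositive on the closure of `Ω`
  set f : X → ℝ := fun y => f₀ y - c with hf
  have hfU : ContMDiffOn 𝓘(ℝ, E) 𝓘(ℝ, ℝ) ∞ f U :=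
    (hf₀s.mono (subset_univ _)).sub contMDiffOn_const
  have hfle : ∀ x ∈ closure Ω, f x ≤ 0 := fun x hx =>
    sub_nonpos.2 (hc (mem_image_of_mem _ hx))
  have hfpos : ∀ x ∈ U, ∀ e, IsPhiPlane φ x e → 0 < hessianTrace f x e := by
    intro x hx e he
    have h1 := hessianTrace_comp (η := fun t => t - c) (by fun_prop) hUo hx
      (hf₀s.mono (subset_univ _)) e
    have h2 : deriv (fun t : ℝ => t - c) = fun _ => 1 := by ext t; simp
    rw [h2, deriv_const, one_mul, zero_mul, add_zero] at h1
    rw [hf, h1, ← he.phiHessian_eq hφ]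
    exact hf₀p x (mem_univ x) e he
  have hηρ : ContMDiffOn 𝓘(ℝ, E) 𝓘(ℝ, ℝ) ∞ (fun y => η (ρ y)) U :=
    hη.contMDiff.comp_contMDiffOn h.smooth
  set g : X → ℝ := fun y => χ (ρ y) * f y with hg
  have hgU : ContMDiffOn 𝓘(ℝ, E) 𝓘(ℝ, ℝ) ∞ g U :=
    (hχ.contMDiff.comp_contMDiffOn h.smooth).mul hfU
  -- `η(ρ)` is plurisubharmonic on the closure of `Ω`, strictly so where `ρ > -δ`
  have hηρform : ∀ x ∈ closure Ω, ∀ e : Fin p → TangentSpace 𝓘(ℝ, E) x,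
      hessianTrace (fun y => η (ρ y)) x e =
        deriv η (ρ x) * (hessianTrace ρ x e + C * dSqTrace ρ x e) +
          (deriv (deriv η) (ρ x) - C * deriv η (ρ x)) * dSqTrace ρ x e := by
    intro x hx e
    rw [hessianTrace_comp hη hUo (hcl hx) h.smooth]
    ring
  have hrest : ∀ (x : X) (e : Fin p → TangentSpace 𝓘(ℝ, E) x),
      0 ≤ (deriv (deriv η) (ρ x) - C * deriv η (ρ x)) * dSqTrace ρ x e := fun x e =>
    mul_nonneg (sub_nonneg.2 (hηconv _)) (dSqTrace_nonneg ρ x e)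
  have hηρpos : ∀ x ∈ closure Ω, -δ < ρ x → ∀ e, IsPhiPlane φ x e →
      0 < hessianTrace (fun y => η (ρ y)) x e := by
    intro x hx hxδ e he
    rw [hηρform x hx e]
    exact add_pos_of_pos_of_nonneg
      (mul_pos (hηpos _ hxδ) (hNpos x (hδN x hx hxδ.le) e he)) (hrest x e)
  have hηρnonneg : ∀ x ∈ closure Ω, ∀ e, IsPhiPlane φ x e →
      0 ≤ hessianTrace (fun y => η (ρ y)) x e := by
    intro x hx e he
    rcases lt_or_ge (-δ) (ρ x) with hxδ | hxδ
    · exact (hηρpos x hx hxδ e he).le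
    · rw [hηρform x hx e, hη0 _ hxδ, zero_mul, zero_add]
      simpa [hη0 _ hxδ] using hrest x e
  -- the constant `K` makes the first summand dominate where `ρ ≥ -δ / 2`
  have hKc : IsCompact (closure Ω ∩ ρ ⁻¹' Ici (-δ / 2)) :=
    hΩc.of_isClosed_subset ((h.smooth.continuousOn.mono hcl).preimage_isClosed_of_isClosed
      isClosed_closure isClosed_Ici) inter_subset_left
  obtain ⟨C₁, hC₁⟩ := exists_forall_isPhiPlane_of_isCompact (φ := φ) hφ.smooth hKc
    (A := fun x e => hessianTrace (fun y => η (ρ y)) x e) (B := fun x e => hessianTrace g x e)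
    (fun x hx => frameContinuousAt_hessianTrace hUo hηρ (hcl hx.1))
    (fun x hx => frameContinuousAt_hessianTrace hUo hgU (hcl hx.1))
    (fun x hx e he => hηρnonneg x hx.1 e he)
    (fun x hx e he => Or.inl (hηρpos x hx.1 (by have : -δ / 2 ≤ ρ x := hx.2; linarith) e he))
  set K := max C₁ 1 with hK
  have hKpos : 0 < K := lt_of_lt_of_le one_pos (le_max_right _ _)
  have hKη : ContMDiffOn 𝓘(ℝ, E) 𝓘(ℝ, ℝ) ∞ (fun y => K * η (ρ y)) U :=
    contMDiffOn_const.mul hηρ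
  set ψ : X → ℝ := (fun y => K * η (ρ y)) + g with hψ
  have hψU : ContMDiffOn 𝓘(ℝ, E) 𝓘(ℝ, ℝ) ∞ ψ U := hKη.add hgU
  have hψpos : ∀ x ∈ closure Ω, ∀ e, IsPhiPlane φ x e → 0 < hessianTrace ψ x e := by
    intro x hx e he
    rw [hψ, hessianTrace_add hUo (hcl hx) hKη hgU, hessianTrace_const_mul K hUo (hcl hx) hηρ,
      add_comm]
    rcases le_or_gt (-δ / 2) (ρ x) with hxδ | hxδ
    · exact hC₁ x ⟨hx, hxδ⟩ e he K (le_max_left _ _)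
    · have hgf : g =ᶠ[𝓝 x] f := by
        filter_upwards [(h.contMDiffAt (hcl hx)).continuousAt.eventually (gt_mem_nhds hxδ)]
          with y hy
        simp only [hg, hχ1 _ (le_of_lt hy), one_mul]
      rw [hessianTrace_congr hUo (hcl hx) hgU hfU hgf]
      exact add_pos_of_pos_of_nonneg (hfpos x (hcl hx) e he)
        (mul_nonneg hKpos.le (hηρnonneg x hx e he))
  obtain ⟨V, hV, hclV, hVU, hVpos⟩ := exists_isOpen_forall_isPhiPlane_pos (φ := φ) hφ.smooth hUo
    (B := fun x e => hessianTrace ψ x e)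
    (fun x hx => frameContinuousAt_hessianTrace hUo hψU hx) hcl hψpos
  refine ⟨ψ, ⟨U, hcl, hUo, hψU, fun x hx => ⟨fun hxΩ => ?_, fun hxψ => ?_⟩, ?_⟩, V, hV, hclV,
    hψU.mono hVU, fun x hx e he => ?_⟩
  · have h1 : K * η (ρ x) < 0 :=
      mul_neg_of_pos_of_neg hKpos (hηneg _ ((h.mem_iff x hx).1 hxΩ))
    have h2 : χ (ρ x) * f x ≤ 0 :=
      mul_nonpos_of_nonneg_of_nonpos (hχ0 _) (hfle x (subset_closure hxΩ))
    exact add_neg_of_neg_of_nonpos h1 h2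
  · by_contra hxΩ
    have hρx : 0 ≤ ρ x := not_lt.1 fun h' => hxΩ ((h.mem_iff x hx).2 h')
    have h1 : ψ x = K * η (ρ x) := by
      simp [hψ, hg, hχz (ρ x) (by linarith)]
    rw [h1] at hxψ
    exact absurd hxψ (not_lt.2 (mul_nonneg hKpos.le (hηnonneg _ hρx)))
  · rintro x ⟨hx, hxΩ⟩
    have hρx := h.eq_zero hΩ hx hxΩ
    have h1 : ψ =ᶠ[𝓝 x] fun y => (fun t => K * η t) (ρ y) := by
      filter_upwards [(h.contMDiffAt hx).continuousAt.eventually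
        (lt_mem_nhds (by rw [hρx]; linarith : -δ / 4 < ρ x))] with y hy
      simp [hψ, hg, hχz (ρ y) (le_of_lt hy)]
    have h2 : deriv (fun t => K * η t) (ρ x) = K * deriv η (ρ x) :=
      deriv_const_mul K (hη.differentiable (by simp) _)
    rw [grad_congr h1, grad_comp ((hη.differentiable (by simp)).const_mul K _)
      (mdifferentiableAt_of_contMDiffOn hUo hx h.smooth), h2]
    refine smul_ne_zero (mul_pos hKpos (hηpos _ ?_)).ne' (h.grad_ne_zero x ⟨hx, hxΩ⟩)
    rw [hρx]
    linarith
  · rw [he.phiHessian_eq hφ]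
    exact hVpos x hx e he

end Extension

end CalibratedGeometry

theorem theorem5p14
    {E : Type*} [NormedAddCommGroup E] [NormedSpace ℝ E] [FiniteDimensional ℝ E]
    {X : Type*} [TopologicalSpace X] [T2Space X] [SecondCountableTopology X]
    [ChartedSpace E X] [IsManifold 𝓘(ℝ, E) ∞ X]
    [RiemannianBundle (fun x : X => TangentSpace 𝓘(ℝ, E) x)]
    [IsContMDiffRiemannianBundle 𝓘(ℝ, E) ∞ E (fun x : X => TangentSpace 𝓘(ℝ, E) x)]
    {p : ℕ} (φ : Π x : X, TangentSpace 𝓘(ℝ, E) x [⋀^Fin p]→L[ℝ] ℝ)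
    (hφ : CalibratedGeometry.IsCalibration φ)
    (hX : CalibratedGeometry.IsStrictlyConvexManifold φ)
    (Ω : Set X) (hΩ : CalibratedGeometry.HasSmoothBoundary E Ω)
    (hΩc : IsCompact (closure Ω)) :
    List.TFAE
      [CalibratedGeometry.IsStrictlyConvexBoundary φ Ω,
       ∀ x ∈ frontier Ω, ∀ e : Fin p → TangentSpace 𝓘(ℝ, E) x,
         CalibratedGeometry.IsTangentialPhiPlane φ Ω x e →
           CalibratedGeometry.traceSecondFundamentalForm Ω x e < 0,
       ∃ ρ : X → ℝ, CalibratedGeometry.IsDefiningFunction E Ω ρ ∧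
         ∃ V : Set X, IsOpen V ∧ closure Ω ⊆ V ∧
           CalibratedGeometry.IsStrictlyPSHOn φ ρ V] := by
  tfae_have 1 → 2 := by
    rintro ⟨ρ, ⟨U, hU, h⟩, hpos⟩ x hx e he
    exact (h.traceSecondFundamentalForm_neg_iff hΩ.1 hφ (hU (frontier_subset_closure hx)) hx
      he).2 (hpos x hx e he)
  tfae_have 2 → 1 := by
    intro hneg
    obtain ⟨ρ, h⟩ := hΩ.exists_global
    exact ⟨ρ, ⟨univ, subset_univ _, h⟩, fun x hx e he =>
      (h.traceSecondFundamentalForm_neg_iff hΩ.1 hφ (mem_univ x) hx he).1 (hneg x hx e he)⟩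
  tfae_have 1 → 3 := by
    rintro ⟨ρ, ⟨U, hU, h⟩, hpos⟩
    refine CalibratedGeometry.exists_strictlyPSH_definingFunction hφ hX hΩ.1 hΩc hU h
      fun x hx e he ht => ?_
    rw [← he.phiHessian_eq hφ]
    exact hpos x hx e ⟨he, fun k => ⟨ρ, U, hU (frontier_subset_closure hx), h, ht k⟩⟩
  tfae_have 3 → 1 := by
    rintro ⟨ρ, hρ, V, -, hV, -, hpos⟩
    exact ⟨ρ, hρ, fun x hx e he => hpos x (hV (frontier_subset_closure hx)) e he.1⟩
  tfae_finish
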